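/- **Conventions.** $f[A]$ is the pointwise image; posets are preordered sets, $q\le p$ meaning that $q$ is stronger; a name for a poset is a pair of names, one for the underlying set and one for an order that is forced to be reflexive and transitive on it. A canonical $\mathbb N$-name for an element of $\dot{\mathbb U}$ is a name obtained by mixing, along a maximal antichain $A$ of $\mathbb N$, names $f(a)$ ($a\in A$) that occur in the name of the underlying set of $\dot{\mathbb U}$ and satisfy $a\Vdash f(a)\in\dot{\mathbb U}$, i.e. $\{\langle z,q\rangle:\exists a\in A\,\exists r\,(\langle z,r\rangle\in f(a),\ q\le a,\ q\le r)\}$. **Restricted memory iterations.** Let $X$ be a set of ordinals. A memory function on $X$ assigns to each $\xi\in X$ a set $b(\xi)\subseteq X\cap\xi$ such that $\zeta\in b(\xi)$ implies $b(\zeta)\subseteq b(\xi)$. A (finite support) restricted memory iteration $\mathbb R$ with domain $X$, memory function $b$ and iterands $\dot{\mathbb U}_\xi$ is the poset of all finite partial functions $p$ on $X$ such that each $p(\xi)$ is a canonical $\mathbb R\restriction b(\xi)$-name for an element of $\dot{\mathbb U}_\xi$, where $\dot{\mathbb U}_\xi$ is an $\mathbb R\restriction b(\xi)$-name for a poset;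 $q\le p$ iff $\operatorname{dom}(p)\subseteq\operatorname{dom}(q)$ and $q\restriction b(\xi)\Vdash_{\mathbb R\restriction b(\xi)}q(\xi)\le p(\xi)$ for all $\xi\in\operatorname{dom}(p)$. A set $Z\subseteq X$ is base-closed if $b(\xi)\subseteq Z$ for all $\xi\in Z$; then $\mathbb R\restriction Z$ is the restriction to conditions with domain $\subseteq Z$ (with all attached functions restricted to $Z$). A bijection $\sigma:X\to X^*$ onto a set of ordinals is an acceptable rearrangement if $\zeta\in b(\xi)$ implies $\sigma(\zeta)<\sigma(\xi)$. It acts recursively by $\sigma(p)(\sigma(\xi))=\sigma(p(\xi))$ and $\sigma(\dot u)=\{\langle\sigma(\dot z),\sigma(p)\rangle:\langle\dot z,p\rangle\in\dot u\}$, and $\sigma(\mathbb R)$ is the restricted memory iteration on $X^*$ with conditions $\sigma(p)$ ($p\in\mathbb R$), the transported order, memory $\sigma(\xi)\mapsto\sigma[b(\xi)]$ and iterands $\sigma(\dot{\mathbb U}_\xi)$. **Alphabets and partition products.** Let $C\subseteq\omega_2\setminus\omega$, and let $\underline{\mathbb P}=\langle\mathbb P_\delta:\delta\in C\rangle$, $\underline{\dot{\mathbb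 Q}}=\langle\dot{\mathbb Q}_\delta:\delta\in C\rangle$, where $\mathbb P_\delta$ is a restricted memory iteration and $\dot{\mathbb Q}_\delta$ is a $\mathbb P_\delta$-name for a poset. A simplified partition product based upon them is a restricted memory iteration $\mathbb R$ with domain $X$ together with functions $\operatorname{index}:X\to C$ and, for $\xi\in X$, acceptable rearrangements $\pi_\xi:\operatorname{dom}(\mathbb P_{\operatorname{index}(\xi)})\to b(\xi)$ of $\mathbb P_{\operatorname{index}(\xi)}$ such that $\mathbb R\restriction b(\xi)=\pi_\xi(\mathbb P_{\operatorname{index}(\xi)})$ and $\dot{\mathbb U}_\xi=\pi_\xi(\dot{\mathbb Q}_{\operatorname{index}(\xi)})$. Put $\operatorname{base}(\xi)=\langle b(\xi),\pi_\xi\rangle$, and for a map $\sigma$ on $X$ put $\sigma(\operatorname{base})(\sigma(\xi))=\langle\sigma[b(\xi)],\sigma\circ\pi_\xi\rangle$, $\sigma(\operatorname{index})(\sigma(\xi))=\operatorname{index}(\xi)$. The pair is a basic alphabet if each $\mathbb P_\delta$ is a simplified partition product based upon $\underline{\mathbb P}\restriction\delta,\underline{\dot{\mathbb Q}}\restriction\delta$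 whose domain is an ordinal $\rho_\delta\le\delta^+$. A collapsing system is a family $\varphi_{\delta,\mu}$ ($\delta\in C$, $\mu<\rho_\delta$), where $\varphi_{\delta,\mu}:\delta\to\mu$ is surjective if $\mu>0$ and $\varphi_{\delta,0}=\emptyset$. For $\bar\delta\le\delta$ in $C$, $\bar\mu<\rho_{\bar\delta}$, $\mu<\rho_\delta$, a set $A\subseteq\mu$ coherently collapses $\langle\delta,\mu\rangle$ to $\langle\bar\delta,\bar\mu\rangle$ if (i) $A=\varphi_{\delta,\mu}[\bar\delta]$; (ii) every limit point of $A$ below $\mu$ of cofinality $\omega$ is in $A$; (iii) if $\mu>\bar\delta$ then $\delta\in A$, $A\cap\delta=\bar\delta$ and $j\circ\varphi_{\delta,\mu}\restriction\bar\delta=\varphi_{\bar\delta,\bar\mu}$, where $j$ is the transitive collapse map of $A$. Triples $\langle x,\pi_x,\alpha\rangle$, $\langle y,\pi_y,\beta\rangle$ with $\alpha\le\beta$ cohere if for every $\zeta\in x\cap y$, with $\mu_x=\pi_x^{-1}(\zeta)$ and $\mu_y=\pi_y^{-1}(\zeta)$, we have $\pi_x[\mu_x]\subseteq\pi_y[\mu_y]$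 and $\pi_y^{-1}[\pi_x[\mu_x]]$ coherently collapses $\langle\beta,\mu_y\rangle$ to $\langle\alpha,\mu_x\rangle$. A partition product is a simplified partition product in which $\mathbb R\restriction b(\xi)=\pi_\xi(\mathbb P_{\operatorname{index}(\xi)})$ also holds for the base and index functions, and in which any two triples $\langle b(\xi),\pi_\xi,\operatorname{index}(\xi)\rangle$ ($\xi\in X$) cohere. A basic alphabet is an alphabet if each $\mathbb P_\delta$ is a partition product based upon $\underline{\mathbb P}\restriction\delta,\underline{\dot{\mathbb Q}}\restriction\delta$. An injection $\sigma:\operatorname{dom}(\mathbb R)\to\operatorname{dom}(\mathbb R^*)$ embeds $\mathbb R$ into $\mathbb R^*$ if it is an acceptable rearrangement onto its range, $\sigma(\operatorname{base}_{\mathbb R})=\operatorname{base}_{\mathbb R^*}\restriction\operatorname{ran}(\sigma)$ and $\sigma(\operatorname{index}_{\mathbb R})=\operatorname{index}_{\mathbb R^*}\restriction\operatorname{ran}(\sigma)$. **Enrichments.** Let $\mathbb R$ be a partition product with domain $X$. An $\mathbb R$-shadow base is a triple $\langle x,\pi_x,\alpha\rangle$ such that $\alpha\in C$, $x\subseteq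 X$ is base-closed, and for some $\gamma\le\rho_\alpha$ the map $\pi_x:\gamma\to x$ is an acceptable rearrangement of $\mathbb P_\alpha\restriction\gamma$ onto $x$ which embeds $\mathbb P_\alpha\restriction\gamma$ into $\mathbb R\restriction x$. An enriched partition product is a pair $(\mathbb R,\mathcal B)$ where $\mathcal B$ is a set of pairwise coherent $\mathbb R$-shadow bases containing $\langle b(\xi),\pi_\xi,\operatorname{index}(\xi)\rangle$ for every $\xi\in X$. A base-closed $Z\subseteq X$ coheres with $(\mathbb R,\mathcal B)$ if $\pi_x[\zeta_0]\subseteq Z$ whenever $\langle x,\pi_x,\alpha\rangle\in\mathcal B$ and $\pi_x(\zeta_0)\in Z$; then $\mathcal B\restriction Z$ is the set of triples $\langle x\cap Z,\pi_{x\cap Z},\alpha\rangle$ with $\langle x,\pi_x,\alpha\rangle\in\mathcal B$, where $\pi_{x\cap Z}$ is the restriction of $\pi_x$ mapping onto $x\cap Z$. A map $\sigma$ embeds $(\mathbb P,\mathcal B)$ into $(\mathbb R,\mathcal D)$ if it embeds $\mathbb P$ into $\mathbb R$ and $\langle\sigma[x],\sigma\circ\pi_x,\alpha\rangle\in\mathcal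 D$ for every $\langle x,\pi_x,\alpha\rangle\in\mathcal B$. **Lemma (Grafting Lemma).** Fix an alphabet $\underline{\mathbb P},\underline{\dot{\mathbb Q}}$ and a collapsing system $\vec\varphi$ for it; all partition products are based upon this alphabet, with respect to $\vec\varphi$. Let $(\mathbb P,\mathcal B)$ and $(\mathbb R,\mathcal D)$ be enriched partition products with domains $X$ and $Y$. Suppose that $\hat X\subseteq X$ coheres with $(\mathbb P,\mathcal B)$ and that $\sigma:\hat X\to Y$ embeds $(\mathbb P\restriction\hat X,\mathcal B\restriction\hat X)$ into $(\mathbb R,\mathcal D)$. Then there is an enriched partition product $(\mathbb R^*,\mathcal D^*)$ with domain $Y^*\supseteq Y$ such that $Y$ is base-closed in $\mathbb R^*$, $\mathbb R^*\restriction Y=\mathbb R$ and $\mathcal D\subseteq\mathcal D^*$, and there is an extension $\sigma^*:X\to Y^*$ of $\sigma$ which embeds $(\mathbb P,\mathcal B)$ into $(\mathbb R^*,\mathcal D^*)$ and satisfies $\sigma^*[X\setminus\hat X]=Y^*\setminus Y$. -/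

import Mathlib

/-!
The set-theoretic universe is `ZFSet.{u}` and the ordinals are `Ordinal.{u}`; the ordinal `ξ`
occurs inside sets as the von Neumann ordinal `ξ.toZFSet`.  Functions between sets of ordinals are
partial functions `PMap`, whose domain is part of the data.
-/

open ZFSet Set Ordinal

universe u

namespace PartitionProducts

/-! ### Partial functions on the ordinals -/

/-- Partial functions from ordinals to ordinals; `b ∈ f a` means that `f(a)` is defined and equal
to `b`. -/
abbrev PMap := Ordinal.{u} → Option Ordinal.{u}

namespace PMap

def Dom (f : PMap.{u}) : Set Ordinal.{u} := {a | ∃ b, b ∈ f a}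

def ran (f : PMap.{u}) : Set Ordinal.{u} := {b | ∃ a, b ∈ f a}

def image (f : PMap.{u}) (s : Set Ordinal.{u}) : Set Ordinal.{u} := {b | ∃ a ∈ s, b ∈ f a}

def preimage (f : PMap.{u}) (s : Set Ordinal.{u}) : Set Ordinal.{u} := {a | ∃ b ∈ s, b ∈ f a}

/-- The composition `f ∘ g`. -/
def comp (f g : PMap.{u}) : PMap.{u} := fun a => (g a).bind f

/-- The empty function. -/
def empty : PMap.{u} := fun _ => none

end PMap

/-! ### Forcing notions, names, forcing -/

/-- A preordered class of conditions (`le q p` means that `q` is stronger than `p`). All the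
instances used below have the empty function `∅` as their greatest element. -/
@[ext]
structure Notion where
  carrier : Set ZFSet.{u}
  le : ZFSet.{u} → ZFSet.{u} → Prop

theorem rank_fst_lt {z p u : ZFSet.{u}} (h : pair z p ∈ u) : z.rank < u.rank := by
  have h1 : z ∈ ({z} : ZFSet) := by simp
  have h2 : ({z} : ZFSet) ∈ pair z p := by simp [pair]
  exact (rank_lt_of_mem h1).trans ((rank_lt_of_mem h2).trans (rank_lt_of_mem h))

theorem rank_snd_lt {z p u : ZFSet.{u}} (h : pair z p ∈ u) : p.rank < u.rank := by
  have h1 : p ∈ ({z, p} : ZFSet) := by simp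
  have h2 : ({z, p} : ZFSet) ∈ pair z p := by simp [pair]
  exact (rank_lt_of_mem h1).trans ((rank_lt_of_mem h2).trans (rank_lt_of_mem h))

/-- `u` is an `N`-name: every element of `u` is a pair of an `N`-name and a condition. -/
inductive IsName (N : Notion.{u}) : ZFSet.{u} → Prop
  | mk (u : ZFSet.{u}) (h₁ : ∀ w ∈ u, ∃ z, ∃ p ∈ N.carrier, w = pair z p)
      (h₂ : ∀ z p, pair z p ∈ u → IsName N z) : IsName N u

/-- `p ⊩ a = b` for names `a`, `b`: for each `⟨c, s⟩ ∈ a`, every `q ≤ p, s` has an extension forcing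
`c` to equal some `d` with `⟨d, r⟩ ∈ b` and `r` in the generic filter, and symmetrically. -/
def ForcesEq (N : Notion.{u}) (a b p : ZFSet.{u}) : Prop :=
  (∀ c s, ∀ _h : pair c s ∈ a, ∀ q ∈ N.carrier, N.le q p → N.le q s →
      ∃ q' ∈ N.carrier, N.le q' q ∧ ∃ d r, pair d r ∈ b ∧ N.le q' r ∧ ForcesEq N c d q') ∧
  (∀ d r, pair d r ∈ b → ∀ q ∈ N.carrier, N.le q p → N.le q r →
      ∃ q' ∈ N.carrier, N.le q' q ∧ ∃ c s, ∃ _h : pair c s ∈ a, N.le q' s ∧ ForcesEq N c d q')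
termination_by a.rank
decreasing_by all_goals exact rank_fst_lt _h

/-- `p ⊩ a ∈ b` for names `a`, `b`. -/
def ForcesMem (N : Notion.{u}) (a b p : ZFSet.{u}) : Prop :=
  ∀ q ∈ N.carrier, N.le q p →
    ∃ q' ∈ N.carrier, N.le q' q ∧ ∃ d r, pair d r ∈ b ∧ N.le q' r ∧ ForcesEq N a d q'

/-- The canonical name for the unordered pair of the objects named by `x` and `y`. -/
noncomputable def upName (x y : ZFSet.{u}) : ZFSet.{u} := {pair x ∅, pair y ∅}

/-- The canonical name for the (Kuratowski) ordered pair of the objects named by `x` and `y`. -/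
noncomputable def opName (x y : ZFSet.{u}) : ZFSet.{u} := upName (upName x x) (upName x y)

/-- A name for a poset, given by a name for the underlying set and a name for the order, the latter
being a set of ordered pairs. -/
@[ext]
structure PosetName where
  under : ZFSet.{u}
  order : ZFSet.{u}

/-- `p ⊩ x ≤ y`, in the sense of the poset named by `Q`. -/
def ForcesLe (N : Notion.{u}) (Q : PosetName.{u}) (x y p : ZFSet.{u}) : Prop :=
  ForcesMem N (opName x y) Q.order p

/-- `Q` is an `N`-name for a poset: every condition forces that the relation named by `Q.order` is
reflexive and transitive on the set named by `Q.under`. -/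
structure IsPosetName (N : Notion.{u}) (Q : PosetName.{u}) : Prop where
  under_name : IsName N Q.under
  order_name : IsName N Q.order
  refl : ∀ p ∈ N.carrier, ∀ x, IsName N x → ForcesMem N x Q.under p → ForcesLe N Q x x p
  trans : ∀ p ∈ N.carrier, ∀ x y z, IsName N x → IsName N y → IsName N z →
    ForcesMem N x Q.under p → ForcesMem N y Q.under p → ForcesMem N z Q.under p →
    ForcesLe N Q x y p → ForcesLe N Q y z p → ForcesLe N Q x z p

/-- `A` is a maximal antichain of `N`. -/
structure IsMaxAntichain (N : Notion.{u}) (A : Set ZFSet.{u}) : Prop where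
  subset : A ⊆ N.carrier
  antichain : ∀ a ∈ A, ∀ b ∈ A, ∀ q ∈ N.carrier, N.le q a → N.le q b → a = b
  maximal : ∀ p ∈ N.carrier, ∃ a ∈ A, ∃ q ∈ N.carrier, N.le q p ∧ N.le q a

/-- `v` is a canonical `N`-name for an element of `Q`: it is obtained by mixing, along a maximal
antichain `A` and a function `f` on `A`, names `f a` which occur in the name for the underlying set
of `Q` and which `a` forces to be elements of it. By the mixing lemma, every name forced to be an
element of `Q` is forced to be equal to a name of this form, and such names form a set. -/
def IsCanonicalElt (N : Notion.{u}) (Q : PosetName.{u}) (v : ZFSet.{u}) : Prop :=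
  ∃ (A : Set ZFSet.{u}) (f : ZFSet.{u} → ZFSet.{u}), IsMaxAntichain N A ∧
    (∀ a ∈ A, (∃ r, pair (f a) r ∈ Q.under) ∧ ForcesMem N (f a) Q.under a) ∧
    ∀ w, w ∈ v ↔ ∃ a ∈ A, ∃ z r q, pair z r ∈ f a ∧ q ∈ N.carrier ∧ N.le q a ∧ N.le q r ∧
      w = pair z q

/-! ### Conditions: finite partial functions on the ordinals -/

/-- `p(ξ) = v`. -/
def Val (p : ZFSet.{u}) (ξ : Ordinal.{u}) (v : ZFSet.{u}) : Prop := pair ξ.toZFSet v ∈ p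

/-- The domain of a condition, as a set of ordinals. -/
def cdom (p : ZFSet.{u}) : Set Ordinal.{u} := {ξ | ∃ v, Val p ξ v}

/-- `p` is a finite partial function on the ordinals. -/
structure IsFinPartial (p : ZFSet.{u}) : Prop where
  finite : {e | e ∈ p}.Finite
  pairs : ∀ e ∈ p, ∃ (ξ : Ordinal.{u}) (v : ZFSet.{u}), e = pair ξ.toZFSet v
  functional : ∀ ξ v w, Val p ξ v → Val p ξ w → v = w

/-- The restriction of a condition to a set of coordinates. -/
noncomputable def cres (p : ZFSet.{u}) (B : Set Ordinal.{u}) : ZFSet.{u} :=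
  ZFSet.sep (fun e => ∃ ξ ∈ B, ∃ v, e = pair ξ.toZFSet v) p

/-! ### The action of a map of coordinates on names and conditions -/

instance small_name_index (u : ZFSet.{u}) :
    Small.{u} {t : ZFSet.{u} × ZFSet.{u} // pair t.1 t.2 ∈ u} := by
  let g : {t : ZFSet.{u} × ZFSet.{u} // pair t.1 t.2 ∈ u} → {w : ZFSet.{u} // w ∈ u} :=
    fun t => ⟨pair t.1.1 t.1.2, t.2⟩
  have hg : Function.Injective g := by
    rintro ⟨⟨a, b⟩, h⟩ ⟨⟨c, d⟩, h'⟩ e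
    have e' : pair a b = pair c d := congrArg Subtype.val e
    obtain ⟨rfl, rfl⟩ := pair_injective e'
    rfl
  have : Small.{u} {w : ZFSet.{u} // w ∈ u} := small_coe u
  exact small_of_injective hg

instance small_cond_index (σ : PMap.{u}) (p : ZFSet.{u}) :
    Small.{u} {t : Ordinal.{u} × Ordinal.{u} × ZFSet.{u} // t.2.1 ∈ σ t.1 ∧ Val p t.1 t.2.2} := by
  let g : {t : Ordinal.{u} × Ordinal.{u} × ZFSet.{u} // t.2.1 ∈ σ t.1 ∧ Val p t.1 t.2.2} →
      {w : ZFSet.{u} // w ∈ p} := fun t => ⟨pair t.1.1.toZFSet t.1.2.2, t.2.2⟩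
  have hg : Function.Injective g := by
    rintro ⟨⟨a, b, c⟩, h, h1⟩ ⟨⟨a', b', c'⟩, h', h1'⟩ e
    have e' : pair a.toZFSet c = pair a'.toZFSet c' := congrArg Subtype.val e
    obtain ⟨e1, rfl⟩ := pair_injective e'
    obtain rfl := toZFSet_injective e1
    obtain rfl := Option.mem_unique h h'
    rfl
  have : Small.{u} {w : ZFSet.{u} // w ∈ p} := small_coe p
  exact small_of_injective hg

/-- The `σ`-rearrangement of a name, `σ(u) = {⟨σ(z), σ(p)⟩ : ⟨z, p⟩ ∈ u}`, where
`σ(p) = {⟨σ(ξ), σ(v)⟩ : p(ξ) = v}`. -/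
noncomputable def rearrName (σ : PMap.{u}) (u : ZFSet.{u}) : ZFSet.{u} :=
  ZFSet.range fun t : {t : ZFSet.{u} × ZFSet.{u} // pair t.1 t.2 ∈ u} =>
    pair (rearrName σ t.1.1)
      (ZFSet.range fun s : {s : Ordinal.{u} × Ordinal.{u} × ZFSet.{u} //
          s.2.1 ∈ σ s.1 ∧ Val t.1.2 s.1 s.2.2} =>
        pair s.1.2.1.toZFSet (rearrName σ s.1.2.2))
termination_by u.rank
decreasing_by
  · exact rank_fst_lt t.2
  · exact (rank_snd_lt s.2.2).trans (rank_snd_lt t.2)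

/-- The `σ`-rearrangement of a condition: `σ(p)(σ(ξ)) = σ(p(ξ))`. -/
noncomputable def rearrCond (σ : PMap.{u}) (p : ZFSet.{u}) : ZFSet.{u} :=
  ZFSet.range fun s : {s : Ordinal.{u} × Ordinal.{u} × ZFSet.{u} //
      s.2.1 ∈ σ s.1 ∧ Val p s.1 s.2.2} => pair s.1.2.1.toZFSet (rearrName σ s.1.2.2)

theorem mem_rearrName {σ : PMap.{u}} {u w : ZFSet.{u}} :
    w ∈ rearrName σ u ↔
      ∃ z p, pair z p ∈ u ∧ w = pair (rearrName σ z) (rearrCond σ p) := by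
  rw [rearrName, ZFSet.mem_range]
  constructor
  · rintro ⟨⟨⟨z, p⟩, h⟩, rfl⟩
    exact ⟨z, p, h, rfl⟩
  · rintro ⟨z, p, h, rfl⟩
    exact ⟨⟨⟨z, p⟩, h⟩, rfl⟩

theorem mem_rearrCond {σ : PMap.{u}} {p w : ZFSet.{u}} :
    w ∈ rearrCond σ p ↔
      ∃ ξ ξ' v, ξ' ∈ σ ξ ∧ Val p ξ v ∧ w = pair ξ'.toZFSet (rearrName σ v) := by
  rw [rearrCond, ZFSet.mem_range]
  constructor
  · rintro ⟨⟨⟨ξ, ξ', v⟩, h, h'⟩, rfl⟩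
    exact ⟨ξ, ξ', v, h, h', rfl⟩
  · rintro ⟨ξ, ξ', v, h, h', rfl⟩
    exact ⟨⟨⟨ξ, ξ', v⟩, h, h'⟩, rfl⟩

/-- The `σ`-rearrangement of a name for a poset. -/
noncomputable def rearrPosetName (σ : PMap.{u}) (Q : PosetName.{u}) :
    PosetName.{u} :=
  ⟨rearrName σ Q.under, rearrName σ Q.order⟩

/-! ### Restricted memory iterations -/

/-- The data of an iteration with restricted memory: the domain `X`, the memory function `b`,
the iterand names, the conditions and the order. -/
@[ext]
structure IterData where
  dom : Set Ordinal.{u}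
  mem : Ordinal.{u} → Set Ordinal.{u}
  iter : Ordinal.{u} → PosetName.{u}
  carrier : Set ZFSet.{u}
  le : ZFSet.{u} → ZFSet.{u} → Prop

/-- The forcing notion of an iteration. -/
def IterData.notion (R : IterData.{u}) : Notion.{u} := ⟨R.carrier, R.le⟩

/-- `Y` is memory closed (base closed) for `R`. -/
def IterData.BaseClosed (R : IterData.{u}) (Y : Set Ordinal.{u}) : Prop :=
  Y ⊆ R.dom ∧ ∀ ξ ∈ Y, R.mem ξ ⊆ Y

open Classical in
/-- The restriction of `R` to `Y` (used for base closed `Y`): the conditions are those with domain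
contained in `Y`, with the same order. -/
noncomputable def IterData.restrict (R : IterData.{u}) (Y : Set Ordinal.{u}) : IterData.{u} where
  dom := R.dom ∩ Y
  mem ξ := if ξ ∈ Y then R.mem ξ else ∅
  iter ξ := if ξ ∈ Y then R.iter ξ else ⟨∅, ∅⟩
  carrier := {p | p ∈ R.carrier ∧ cdom p ⊆ Y}
  le q p := R.le q p ∧ cdom q ⊆ Y ∧ cdom p ⊆ Y

/-- `R` is a finite support restricted memory iteration. The domain is a set (not a proper class)
of ordinals; functions on the domain are coded by total functions taking default values outside
the domain. -/
structure IsRMI (R : IterData.{u}) : Prop where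
  dom_bdd : BddAbove R.dom
  mem_subset : ∀ ξ ∈ R.dom, R.mem ξ ⊆ R.dom ∩ Iio ξ
  mem_trans : ∀ ξ ∈ R.dom, ∀ ζ ∈ R.mem ξ, R.mem ζ ⊆ R.mem ξ
  iter_name : ∀ ξ ∈ R.dom, IsPosetName (R.restrict (R.mem ξ)).notion (R.iter ξ)
  mem_carrier : ∀ p, p ∈ R.carrier ↔ IsFinPartial p ∧ cdom p ⊆ R.dom ∧
    ∀ ξ v, Val p ξ v → IsCanonicalElt (R.restrict (R.mem ξ)).notion (R.iter ξ) v
  le_iff : ∀ q p, R.le q p ↔ q ∈ R.carrier ∧ p ∈ R.carrier ∧ cdom p ⊆ cdom q ∧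
    ∀ ξ v w, Val p ξ v → Val q ξ w →
      ForcesLe (R.restrict (R.mem ξ)).notion (R.iter ξ) w v (cres q (R.mem ξ))
  mem_off : ∀ ξ ∉ R.dom, R.mem ξ = ∅
  iter_off : ∀ ξ ∉ R.dom, R.iter ξ = ⟨∅, ∅⟩

/-- `σ` is a bijection of `X` onto `X'`. -/
structure IsBij (σ : PMap.{u}) (X X' : Set Ordinal.{u}) : Prop where
  dom_eq : σ.Dom = X
  ran_eq : σ.ran = X'
  inj : ∀ ξ ζ η, η ∈ σ ξ → η ∈ σ ζ → ξ = ζ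

/-- `σ : X → X'` is an acceptable rearrangement of `X, b`. -/
structure IsAcceptable (σ : PMap.{u}) (X : Set Ordinal.{u})
    (b : Ordinal.{u} → Set Ordinal.{u}) (X' : Set Ordinal.{u}) : Prop where
  bij : IsBij σ X X'
  lt : ∀ ξ ∈ X, ∀ ζ ∈ X, ζ ∈ b ξ → ∀ ξ' ∈ σ ξ, ∀ ζ' ∈ σ ζ, ζ' < ξ'

/-- `R'` is the `σ`-rearrangement of `R`, as restricted memory iterations. -/
structure IsRearrangement (σ : PMap.{u}) (R R' : IterData.{u}) : Prop where
  acceptable : IsAcceptable σ R.dom R.mem R'.dom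
  mem_eq : ∀ ξ ∈ R.dom, ∀ ξ' ∈ σ ξ, R'.mem ξ' = σ.image (R.mem ξ)
  iter_eq : ∀ ξ ∈ R.dom, ∀ ξ' ∈ σ ξ, R'.iter ξ' = rearrPosetName σ (R.iter ξ)
  carrier_eq : R'.carrier = rearrCond σ '' R.carrier
  le_iff : ∀ q ∈ R.carrier, ∀ p ∈ R.carrier, R'.le (rearrCond σ q) (rearrCond σ p) ↔ R.le q p

/-! ### Partition products -/

/-- The data of a simplified partition product: an iteration together with the index function and
the rearrangement functions `π_ξ`. -/
@[ext]
structure PPData extends IterData.{u} where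
  index : Ordinal.{u} → Ordinal.{u}
  rmap : Ordinal.{u} → PMap.{u}

open Classical in
/-- The restriction of a (simplified) partition product to `Y` (used for base closed `Y`). -/
noncomputable def PPData.restrict (R : PPData.{u}) (Y : Set Ordinal.{u}) : PPData.{u} where
  toIterData := R.toIterData.restrict Y
  index ξ := if ξ ∈ Y then R.index ξ else 0
  rmap ξ := if ξ ∈ Y then R.rmap ξ else PMap.empty

/-- The base and index functions of `R'` on the range of `σ` are the `σ`-rearrangements of those
of `R`. -/
structure TransfersBase (σ : PMap.{u}) (R R' : PPData.{u}) : Prop where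
  mem_eq : ∀ ξ ∈ R.dom, ∀ ξ' ∈ σ ξ, R'.mem ξ' = σ.image (R.mem ξ)
  rmap_eq : ∀ ξ ∈ R.dom, ∀ ξ' ∈ σ ξ, R'.rmap ξ' = σ.comp (R.rmap ξ)
  index_eq : ∀ ξ ∈ R.dom, ∀ ξ' ∈ σ ξ, R'.index ξ' = R.index ξ

/-- `R'` is the `σ`-rearrangement of `R`, as simplified partition products. -/
structure IsPPRearrangement (σ : PMap.{u}) (R R' : PPData.{u}) : Prop where
  iteration : IsRearrangement σ R.toIterData R'.toIterData
  base : TransfersBase σ R R'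

/-- The data of an alphabet: a set `C` of ordinals with sequences `⟨P δ : δ ∈ C⟩` and
`⟨Q δ : δ ∈ C⟩` (values outside `C` are irrelevant). -/
structure AlphabetData where
  C : Set Ordinal.{u}
  P : Ordinal.{u} → PPData.{u}
  Q : Ordinal.{u} → PosetName.{u}

/-- The restriction of both sequences to indices below `δ`. -/
def AlphabetData.below (𝒜 : AlphabetData.{u}) (δ : Ordinal.{u}) : AlphabetData.{u} :=
  ⟨𝒜.C ∩ Iio δ, 𝒜.P, 𝒜.Q⟩

/-- `R` is a simplified partition product based upon the alphabet `𝒜`. -/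
structure IsSimplifiedPP (𝒜 : AlphabetData.{u}) (R : PPData.{u}) : Prop where
  rmi : IsRMI R.toIterData
  index_mem : ∀ ξ ∈ R.dom, R.index ξ ∈ 𝒜.C
  rearr : ∀ ξ ∈ R.dom,
    IsRearrangement (R.rmap ξ) (𝒜.P (R.index ξ)).toIterData (R.restrict (R.mem ξ)).toIterData
  iter_eq : ∀ ξ ∈ R.dom, R.iter ξ = rearrPosetName (R.rmap ξ) (𝒜.Q (R.index ξ))
  index_off : ∀ ξ ∉ R.dom, R.index ξ = 0
  rmap_off : ∀ ξ ∉ R.dom, R.rmap ξ = PMap.empty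

/-- A basic alphabet on a subset `C` of `ω₂ \ ω`; the domain of `P δ` is an ordinal
`ρ_δ ≤ δ⁺`. -/
structure IsBasicAlphabet (𝒜 : AlphabetData.{u}) : Prop where
  C_subset : ∀ δ ∈ 𝒜.C, ω ≤ δ ∧ δ < ω_ 2
  simplified : ∀ δ ∈ 𝒜.C, IsSimplifiedPP (𝒜.below δ) (𝒜.P δ)
  poset : ∀ δ ∈ 𝒜.C, IsPosetName (𝒜.P δ).notion (𝒜.Q δ)
  dom_eq : ∀ δ ∈ 𝒜.C, ∃ ρ ≤ (Order.succ δ.card).ord, (𝒜.P δ).dom = Iio ρ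

/-- A collapsing system: `φ δ μ` maps `δ` onto `μ`, for `δ ∈ C` and `μ < ρ_δ`. For `μ = 0` there is
no total function from `δ` to `μ`, and `φ δ 0` is the empty function. -/
structure IsCollapsingSystem (𝒜 : AlphabetData.{u})
    (φ : Ordinal.{u} → Ordinal.{u} → PMap.{u}) : Prop where
  dom_subset : ∀ δ ∈ 𝒜.C, ∀ μ ∈ (𝒜.P δ).dom, (φ δ μ).Dom ⊆ Iio δ
  dom_eq : ∀ δ ∈ 𝒜.C, ∀ μ ∈ (𝒜.P δ).dom, μ ≠ 0 → (φ δ μ).Dom = Iio δ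
  ran_eq : ∀ δ ∈ 𝒜.C, ∀ μ ∈ (𝒜.P δ).dom, (φ δ μ).ran = Iio μ

/-- `j` is the transitive collapse map of the set `A` of ordinals. -/
def IsCollapse (j : Ordinal.{u} → Ordinal.{u}) (A : Set Ordinal.{u}) : Prop :=
  StrictMonoOn j A ∧ ∃ γ, j '' A = Iio γ

/-- `A` coherently collapses `⟨δ, μ⟩` to `⟨δ', μ'⟩`. -/
structure CoherentlyCollapses (φ : Ordinal.{u} → Ordinal.{u} → PMap.{u})
    (A : Set Ordinal.{u}) (δ μ δ' μ' : Ordinal.{u}) : Prop where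
  subset : A ⊆ Iio μ
  eq_image : A = (φ δ μ).image (Iio δ')
  closed : ∀ ν < μ, ν.cof = Cardinal.aleph0 → (∀ τ < ν, ∃ a ∈ A, τ < a ∧ a < ν) → ν ∈ A
  collapse : δ' < μ → δ ∈ A ∧ A ∩ Iio δ = Iio δ' ∧
    ∃ j, IsCollapse j A ∧ ∀ i < δ', (φ δ μ i).map j = φ δ' μ' i

/-- A triple `⟨x, π_x, α⟩`. -/
@[ext]
structure Triple where
  set : Set Ordinal.{u}
  map : PMap.{u}
  index : Ordinal.{u}

/-- The condition for coherence of the triples `s = ⟨x, π_x, α⟩` and `t = ⟨y, π_y, β⟩`, in the order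
given: if `α ≤ β` then the overlap of `x` and `y` is as required. -/
def Triple.CoheresTo (φ : Ordinal.{u} → Ordinal.{u} → PMap.{u})
    (s t : Triple.{u}) : Prop :=
  s.index ≤ t.index → ∀ ζ ∈ s.set ∩ t.set, ∀ μx μy, ζ ∈ s.map μx → ζ ∈ t.map μy →
    s.map.image (Iio μx) ⊆ t.map.image (Iio μy) ∧
    CoherentlyCollapses φ (t.map.preimage (s.map.image (Iio μx))) t.index μy s.index μx

/-- A collection of triples is coherent if any two of its elements cohere; the quantification covers
both orders of a pair. -/
def Coherent (φ : Ordinal.{u} → Ordinal.{u} → PMap.{u})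
    (B : Set Triple.{u}) : Prop :=
  ∀ s ∈ B, ∀ t ∈ B, s.CoheresTo φ t

/-- The triple `⟨b(ξ), π_ξ, index(ξ)⟩`. -/
def PPData.baseTriple (R : PPData.{u}) (ξ : Ordinal.{u}) : Triple.{u} :=
  ⟨R.mem ξ, R.rmap ξ, R.index ξ⟩

/-- `R` is a partition product based upon `𝒜`, with respect to `φ`. -/
structure IsPP (𝒜 : AlphabetData.{u})
    (φ : Ordinal.{u} → Ordinal.{u} → PMap.{u}) (R : PPData.{u}) : Prop where
  simplified : IsSimplifiedPP 𝒜 R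
  rearr : ∀ ξ ∈ R.dom, IsPPRearrangement (R.rmap ξ) (𝒜.P (R.index ξ)) (R.restrict (R.mem ξ))
  coherent : ∀ ξ₁ ∈ R.dom, ∀ ξ₂ ∈ R.dom, (R.baseTriple ξ₁).CoheresTo φ (R.baseTriple ξ₂)

/-- An alphabet: a basic alphabet in which every `P δ` is a partition product based upon the
alphabet below `δ`. -/
structure IsAlphabet (𝒜 : AlphabetData.{u})
    (φ : Ordinal.{u} → Ordinal.{u} → PMap.{u}) : Prop where
  basic : IsBasicAlphabet 𝒜
  pp : ∀ δ ∈ 𝒜.C, IsPP (𝒜.below δ) φ (𝒜.P δ)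

/-- `σ` embeds the partition product `R` into the partition product `R'`. -/
structure Embeds (σ : PMap.{u}) (R R' : PPData.{u}) : Prop where
  ran_subset : σ.ran ⊆ R'.dom
  acceptable : IsAcceptable σ R.dom R.mem σ.ran
  base : TransfersBase σ R R'

/-! ### Shadow bases and enrichments -/

/-- `⟨x, π_x, α⟩` is a shadow base: `α ∈ C`, and `π_x` is an acceptable rearrangement of
`P_α ↾ γ` onto `x` for some `γ ≤ ρ_α`. -/
def IsShadowBase (𝒜 : AlphabetData.{u}) (s : Triple.{u}) : Prop :=
  s.index ∈ 𝒜.C ∧ ∃ γ, Iio γ ⊆ (𝒜.P s.index).dom ∧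
    IsAcceptable s.map (Iio γ) ((𝒜.P s.index).restrict (Iio γ)).mem s.set

/-- `⟨x, π_x, α⟩` is an `R`-shadow base: moreover `x` is base closed in `R` and `π_x` embeds
`P_α ↾ γ` into `R ↾ x`, where `γ` is the domain of `π_x`. -/
structure IsShadowBaseOf (𝒜 : AlphabetData.{u}) (R : PPData.{u}) (s : Triple.{u}) : Prop where
  shadow : IsShadowBase 𝒜 s
  closed : R.BaseClosed s.set
  embeds : Embeds s.map ((𝒜.P s.index).restrict s.map.Dom) (R.restrict s.set)

/-- `B` is an enrichment of `R`: a coherent and `R`-full collection of `R`-shadow bases. -/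
structure IsEnrichment (𝒜 : AlphabetData.{u})
    (φ : Ordinal.{u} → Ordinal.{u} → PMap.{u}) (R : PPData.{u})
    (B : Set Triple.{u}) : Prop where
  shadow : ∀ s ∈ B, IsShadowBaseOf 𝒜 R s
  coherent : Coherent φ B
  full : ∀ ξ ∈ R.dom, R.baseTriple ξ ∈ B

/-- `(R, B)` is an enriched partition product. -/
structure IsEnrichedPP (𝒜 : AlphabetData.{u})
    (φ : Ordinal.{u} → Ordinal.{u} → PMap.{u}) (R : PPData.{u})
    (B : Set Triple.{u}) : Prop where
  pp : IsPP 𝒜 φ R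
  enrichment : IsEnrichment 𝒜 φ R B

/-- The base closed set `Z` coheres with `(R, B)`. -/
structure SetCoheres (R : PPData.{u}) (B : Set Triple.{u}) (Z : Set Ordinal.{u}) : Prop where
  closed : R.BaseClosed Z
  initial : ∀ s ∈ B, ∀ ζ ∈ Z ∩ s.set, ∀ ζ₀, ζ ∈ s.map ζ₀ → s.map.image (Iio ζ₀) ⊆ Z

open Classical in
/-- The triple `⟨x ∩ Z, π_{x ∩ Z}, α⟩`, where `π_{x ∩ Z}` is the restriction of `π_x` mapping onto
`x ∩ Z`. -/
noncomputable def Triple.restrict (s : Triple.{u}) (Z : Set Ordinal.{u}) : Triple.{u} where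
  set := s.set ∩ Z
  map i := (s.map i).bind fun v => if v ∈ Z then some v else none
  index := s.index

/-- The triple `σ(⟨x, π_x, α⟩) = ⟨σ[x], σ ∘ π_x, α⟩`. -/
def Triple.push (σ : PMap.{u}) (s : Triple.{u}) : Triple.{u} :=
  ⟨σ.image s.set, σ.comp s.map, s.index⟩

/-- `σ` embeds `(P, B)` into `(R, D)`, for enriched partition products. -/
structure EmbedsEnriched (σ : PMap.{u}) (P : PPData.{u}) (B : Set Triple.{u})
    (R : PPData.{u}) (D : Set Triple.{u}) : Prop where
  embeds : Embeds σ P R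
  push_subset : Triple.push σ '' B ⊆ D

end PartitionProducts

namespace PartitionProducts

/-! ### Rearrangements of names -/

theorem val_rearrCond {σ : PMap.{u}} {p v' : ZFSet.{u}} {ξ' : Ordinal.{u}} :
    Val (rearrCond σ p) ξ' v' ↔ ∃ ξ v, ξ' ∈ σ ξ ∧ Val p ξ v ∧ v' = rearrName σ v := by
  rw [Val, mem_rearrCond]
  constructor
  · rintro ⟨ξ, ζ, v, h, hv, e⟩
    obtain ⟨e₁, rfl⟩ := pair_injective e
    obtain rfl := toZFSet_injective e₁
    exact ⟨ξ, v, h, hv, rfl⟩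
  · rintro ⟨ξ, v, h, hv, rfl⟩
    exact ⟨ξ, ξ', v, h, hv, rfl⟩

theorem pair_mem_rearrName {σ : PMap.{u}} {u z' p' : ZFSet.{u}} :
    pair z' p' ∈ rearrName σ u ↔
      ∃ z p, pair z p ∈ u ∧ z' = rearrName σ z ∧ p' = rearrCond σ p := by
  rw [mem_rearrName]
  constructor
  · rintro ⟨z, p, h, e⟩
    obtain ⟨rfl, rfl⟩ := pair_injective e
    exact ⟨z, p, h, rfl, rfl⟩
  · rintro ⟨z, p, h, rfl, rfl⟩
    exact ⟨z, p, h, rfl⟩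

theorem rank_lt_of_val {p v : ZFSet.{u}} {ξ : Ordinal.{u}} (h : Val p ξ v) : v.rank < p.rank :=
  rank_snd_lt h

theorem rearrCond_comp_of {σ τ : PMap.{u}} {p : ZFSet.{u}}
    (h : ∀ ξ v, Val p ξ v → rearrName (σ.comp τ) v = rearrName σ (rearrName τ v)) :
    rearrCond (σ.comp τ) p = rearrCond σ (rearrCond τ p) := by
  ext w
  rw [mem_rearrCond, mem_rearrCond]
  constructor
  · rintro ⟨ξ, ξ', v, hξ, hv, rfl⟩
    obtain ⟨ζ, hζ, hζ'⟩ := Option.bind_eq_some_iff.1 hξ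
    exact ⟨ζ, ξ', rearrName τ v, hζ', val_rearrCond.2 ⟨ξ, v, hζ, hv, rfl⟩, by rw [h ξ v hv]⟩
  · rintro ⟨ζ, ξ', v', hζ, hv', rfl⟩
    obtain ⟨ξ, v, hξ, hv, rfl⟩ := val_rearrCond.1 hv'
    exact ⟨ξ, ξ', v, Option.bind_eq_some_iff.2 ⟨ζ, hξ, hζ⟩, hv, by rw [h ξ v hv]⟩

theorem rearrName_comp (σ τ : PMap.{u}) (u : ZFSet.{u}) :
    rearrName (σ.comp τ) u = rearrName σ (rearrName τ u) := by
  have hc : ∀ z p, pair z p ∈ u →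
      rearrCond (σ.comp τ) p = rearrCond σ (rearrCond τ p) := fun z p h =>
    rearrCond_comp_of fun ξ v hv => rearrName_comp σ τ v
  have hn : ∀ z p, pair z p ∈ u →
      rearrName (σ.comp τ) z = rearrName σ (rearrName τ z) := fun z p h =>
    rearrName_comp σ τ z
  ext w
  rw [mem_rearrName, mem_rearrName]
  constructor
  · rintro ⟨z, p, h, rfl⟩
    exact ⟨_, _, pair_mem_rearrName.2 ⟨z, p, h, rfl, rfl⟩, by rw [hc z p h, hn z p h]⟩
  · rintro ⟨z', p', h', rfl⟩
    obtain ⟨z, p, h, rfl, rfl⟩ := pair_mem_rearrName.1 h'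
    exact ⟨z, p, h, by rw [hc z p h, hn z p h]⟩
termination_by u.rank
decreasing_by
  · exact (rank_lt_of_val hv).trans (rank_snd_lt h)
  · exact rank_fst_lt h

theorem rearrCond_comp (σ τ : PMap.{u}) (p : ZFSet.{u}) :
    rearrCond (σ.comp τ) p = rearrCond σ (rearrCond τ p) :=
  rearrCond_comp_of fun _ v _ => rearrName_comp σ τ v

theorem rearrPosetName_comp (σ τ : PMap.{u}) (Q : PosetName.{u}) :
    rearrPosetName (σ.comp τ) Q = rearrPosetName σ (rearrPosetName τ Q) := by
  simp [rearrPosetName, rearrName_comp]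

theorem rearrCond_empty (σ : PMap.{u}) : rearrCond σ ∅ = ∅ := by
  refine (ZFSet.eq_empty _).2 fun w hw => ?_
  obtain ⟨_, _, _, _, h, _⟩ := mem_rearrCond.1 hw
  exact notMem_empty _ h

theorem rearrName_upName (σ : PMap.{u}) (x y : ZFSet.{u}) :
    rearrName σ (upName x y) = upName (rearrName σ x) (rearrName σ y) := by
  ext w
  rw [mem_rearrName]
  simp only [upName, ZFSet.mem_pair]
  constructor
  · rintro ⟨z, p, h | h, rfl⟩ <;> obtain ⟨rfl, rfl⟩ := pair_injective h <;>
      simp [rearrCond_empty]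
  · rintro (rfl | rfl)
    · exact ⟨x, ∅, Or.inl rfl, by rw [rearrCond_empty]⟩
    · exact ⟨y, ∅, Or.inr rfl, by rw [rearrCond_empty]⟩

theorem rearrName_opName (σ : PMap.{u}) (x y : ZFSet.{u}) :
    rearrName σ (opName x y) = opName (rearrName σ x) (rearrName σ y) := by
  simp [opName, rearrName_upName]

/-! ### Names -/

theorem IsName.left {N : Notion.{u}} {u z p : ZFSet.{u}} (hu : IsName N u) (h : pair z p ∈ u) :
    IsName N z := by
  cases hu with
  | mk _ _ h₂ => exact h₂ z p h

theorem IsName.right {N : Notion.{u}} {u z p : ZFSet.{u}} (hu : IsName N u) (h : pair z p ∈ u) :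
    p ∈ N.carrier := by
  cases hu with
  | mk _ h₁ _ =>
    obtain ⟨z', p', hp, e⟩ := h₁ _ h
    obtain ⟨rfl, rfl⟩ := pair_injective e
    exact hp

theorem IsName.exists_eq {N : Notion.{u}} {u w : ZFSet.{u}} (hu : IsName N u) (h : w ∈ u) :
    ∃ z p, w = pair z p := by
  cases hu with
  | mk _ h₁ _ =>
    obtain ⟨z, p, _, e⟩ := h₁ _ h
    exact ⟨z, p, e⟩

theorem isName_iff {N : Notion.{u}} {u : ZFSet.{u}} :
    IsName N u ↔ ∀ w ∈ u, ∃ z p, w = pair z p ∧ p ∈ N.carrier ∧ IsName N z := by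
  constructor
  · intro hu w hw
    obtain ⟨z, p, rfl⟩ := hu.exists_eq hw
    exact ⟨z, p, rfl, hu.right hw, hu.left hw⟩
  · intro h
    refine IsName.mk u (fun w hw => ?_) fun z p hzp => ?_
    · obtain ⟨z, p, e, hp, _⟩ := h w hw
      exact ⟨z, p, hp, e⟩
    · obtain ⟨z', p', e, _, hz⟩ := h _ hzp
      obtain ⟨rfl, rfl⟩ := pair_injective e
      exact hz

theorem isName_upName {N : Notion.{u}} (h₀ : ∅ ∈ N.carrier) {x y : ZFSet.{u}}
    (hx : IsName N x) (hy : IsName N y) : IsName N (upName x y) := by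
  refine isName_iff.2 fun w hw => ?_
  rcases ZFSet.mem_pair.1 hw with rfl | rfl
  exacts [⟨x, ∅, rfl, h₀, hx⟩, ⟨y, ∅, rfl, h₀, hy⟩]

theorem isName_opName {N : Notion.{u}} (h₀ : ∅ ∈ N.carrier) {x y : ZFSet.{u}}
    (hx : IsName N x) (hy : IsName N y) : IsName N (opName x y) :=
  isName_upName h₀ (isName_upName h₀ hx hx) (isName_upName h₀ hx hy)

theorem IsCanonicalElt.isName {N : Notion.{u}} {Q : PosetName.{u}} {v : ZFSet.{u}}
    (h : IsCanonicalElt N Q v) (hQ : IsName N Q.under) : IsName N v := by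
  obtain ⟨A, f, -, hf, hv⟩ := h
  refine isName_iff.2 fun w hw => ?_
  obtain ⟨a, ha, z, r, q, hz, hq, -, -, rfl⟩ := (hv w).1 hw
  obtain ⟨⟨s, hs⟩, -⟩ := hf a ha
  exact ⟨z, q, rfl, hq, (hQ.left hs).left hz⟩

/-! ### Isomorphisms of forcing notions given by rearrangements -/

/-- The rearrangement of conditions by `σ` is an isomorphism of `N` onto `N'`, and its inverse is
the rearrangement by `τ`. -/
structure NotionIso (σ τ : PMap.{u}) (N N' : Notion.{u}) : Prop where
  empty_mem : ∅ ∈ N.carrier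
  map_mem : ∀ p ∈ N.carrier, rearrCond σ p ∈ N'.carrier
  inv_mem : ∀ p ∈ N'.carrier, rearrCond τ p ∈ N.carrier
  left_inv : ∀ p ∈ N.carrier, rearrCond τ (rearrCond σ p) = p
  right_inv : ∀ p ∈ N'.carrier, rearrCond σ (rearrCond τ p) = p
  le_iff : ∀ q ∈ N.carrier, ∀ p ∈ N.carrier, N'.le (rearrCond σ q) (rearrCond σ p) ↔ N.le q p

namespace NotionIso

variable {σ τ : PMap.{u}} {N N' : Notion.{u}}

theorem symm (i : NotionIso σ τ N N') : NotionIso τ σ N' N where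
  empty_mem := by simpa [rearrCond_empty] using i.map_mem ∅ i.empty_mem
  map_mem := i.inv_mem
  inv_mem := i.map_mem
  left_inv := i.right_inv
  right_inv := i.left_inv
  le_iff q hq p hp := by
    rw [← i.le_iff _ (i.inv_mem q hq) _ (i.inv_mem p hp), i.right_inv q hq, i.right_inv p hp]

theorem carrier_eq (i : NotionIso σ τ N N') : N'.carrier = rearrCond σ '' N.carrier := by
  ext p
  constructor
  · exact fun hp => ⟨_, i.inv_mem p hp, i.right_inv p hp⟩
  · rintro ⟨p, hp, rfl⟩
    exact i.map_mem p hp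

theorem exists_eq (i : NotionIso σ τ N N') {q : ZFSet.{u}} (hq : q ∈ N'.carrier) :
    ∃ p ∈ N.carrier, q = rearrCond σ p :=
  ⟨_, i.inv_mem q hq, (i.right_inv q hq).symm⟩

theorem isName (i : NotionIso σ τ N N') {u : ZFSet.{u}} (hu : IsName N u) :
    IsName N' (rearrName σ u) := by
  induction hu with
  | mk u h₁ h₂ ih =>
    refine isName_iff.2 fun w hw => ?_
    obtain ⟨z, p, h, rfl⟩ := mem_rearrName.1 hw
    exact ⟨_, _, rfl, i.map_mem p ((IsName.mk u h₁ h₂).right h), ih z p h⟩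

theorem rearrName_left_inv (i : NotionIso σ τ N N') {u : ZFSet.{u}} (hu : IsName N u) :
    rearrName τ (rearrName σ u) = u := by
  induction hu with
  | mk u h₁ h₂ ih =>
    have hu := IsName.mk u h₁ h₂
    ext w
    rw [mem_rearrName]
    constructor
    · rintro ⟨z', p', h', rfl⟩
      obtain ⟨z, p, h, rfl, rfl⟩ := pair_mem_rearrName.1 h'
      rwa [ih z p h, i.left_inv p (hu.right h)]
    · intro hw
      obtain ⟨z, p, rfl⟩ := hu.exists_eq hw
      exact ⟨_, _, pair_mem_rearrName.2 ⟨z, p, hw, rfl, rfl⟩, by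
        rw [ih z p hw, i.left_inv p (hu.right hw)]⟩

theorem exists_name_eq (i : NotionIso σ τ N N') {u : ZFSet.{u}} (hu : IsName N' u) :
    ∃ v, IsName N v ∧ u = rearrName σ v :=
  ⟨_, i.symm.isName hu, (i.symm.rearrName_left_inv hu).symm⟩

theorem forcesEq_map (i : NotionIso σ τ N N') {a b p : ZFSet.{u}} (ha : IsName N a)
    (hb : IsName N b) (hp : p ∈ N.carrier) (h : ForcesEq N a b p) :
    ForcesEq N' (rearrName σ a) (rearrName σ b) (rearrCond σ p) := by
  induction ha generalizing b p with
  | mk a h₁ h₂ ih =>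
    have ha := IsName.mk a h₁ h₂
    rw [ForcesEq] at h ⊢
    obtain ⟨hl, hr⟩ := h
    constructor
    · intro c' s' hcs' q hq hqp hqs
      obtain ⟨c, s, hcs, rfl, rfl⟩ := pair_mem_rearrName.1 hcs'
      replace hq := i.exists_eq hq
      obtain ⟨q, hq, rfl⟩ := hq
      obtain ⟨q', hq', hle, d, r, hdr, hr', he⟩ := hl c s hcs q hq ((i.le_iff q hq p hp).1 hqp)
        ((i.le_iff q hq s (ha.right hcs)).1 hqs)
      exact ⟨_, i.map_mem q' hq', (i.le_iff _ hq' _ hq).2 hle, _, _,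
        pair_mem_rearrName.2 ⟨d, r, hdr, rfl, rfl⟩, (i.le_iff _ hq' _ (hb.right hdr)).2 hr',
        ih c s hcs (hb.left hdr) hq' he⟩
    · intro d' r' hdr' q hq hqp hqr
      obtain ⟨d, r, hdr, rfl, rfl⟩ := pair_mem_rearrName.1 hdr'
      replace hq := i.exists_eq hq
      obtain ⟨q, hq, rfl⟩ := hq
      obtain ⟨q', hq', hle, c, s, hcs, hs', he⟩ := hr d r hdr q hq ((i.le_iff q hq p hp).1 hqp)
        ((i.le_iff q hq r (hb.right hdr)).1 hqr)
      exact ⟨_, i.map_mem q' hq', (i.le_iff _ hq' _ hq).2 hle, _, _,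
        pair_mem_rearrName.2 ⟨c, s, hcs, rfl, rfl⟩, (i.le_iff _ hq' _ (ha.right hcs)).2 hs',
        ih c s hcs (hb.left hdr) hq' he⟩

theorem forcesMem_map (i : NotionIso σ τ N N') {a b p : ZFSet.{u}} (ha : IsName N a)
    (hb : IsName N b) (hp : p ∈ N.carrier) (h : ForcesMem N a b p) :
    ForcesMem N' (rearrName σ a) (rearrName σ b) (rearrCond σ p) := by
  intro q hq hqp
  replace hq := i.exists_eq hq
  obtain ⟨q, hq, rfl⟩ := hq
  obtain ⟨q', hq', hle, d, r, hdr, hr', he⟩ := h q hq ((i.le_iff q hq p hp).1 hqp)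
  exact ⟨_, i.map_mem q' hq', (i.le_iff _ hq' _ hq).2 hle, _, _,
    pair_mem_rearrName.2 ⟨d, r, hdr, rfl, rfl⟩, (i.le_iff _ hq' _ (hb.right hdr)).2 hr',
    i.forcesEq_map ha (hb.left hdr) hq' he⟩

theorem forcesMem_iff (i : NotionIso σ τ N N') {a b p : ZFSet.{u}} (ha : IsName N a)
    (hb : IsName N b) (hp : p ∈ N.carrier) :
    ForcesMem N' (rearrName σ a) (rearrName σ b) (rearrCond σ p) ↔ ForcesMem N a b p := by
  refine ⟨fun h => ?_, i.forcesMem_map ha hb hp⟩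
  have := i.symm.forcesMem_map (i.isName ha) (i.isName hb) (i.map_mem p hp) h
  rwa [i.rearrName_left_inv ha, i.rearrName_left_inv hb, i.left_inv p hp] at this

theorem forcesLe_iff (i : NotionIso σ τ N N') {Q : PosetName.{u}} {x y p : ZFSet.{u}}
    (hQ : IsName N Q.order) (hx : IsName N x) (hy : IsName N y) (hp : p ∈ N.carrier) :
    ForcesLe N' (rearrPosetName σ Q) (rearrName σ x) (rearrName σ y) (rearrCond σ p) ↔
      ForcesLe N Q x y p := by
  rw [ForcesLe, ForcesLe, ← rearrName_opName]
  exact i.forcesMem_iff (isName_opName i.empty_mem hx hy) hQ hp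

theorem isPosetName (i : NotionIso σ τ N N') {Q : PosetName.{u}} (hQ : IsPosetName N Q) :
    IsPosetName N' (rearrPosetName σ Q) where
  under_name := i.isName hQ.under_name
  order_name := i.isName hQ.order_name
  refl := by
    intro p hp x hx h
    replace hp := i.exists_eq hp
    obtain ⟨p, hp, rfl⟩ := hp
    replace hx := i.exists_name_eq hx
    obtain ⟨x, hx, rfl⟩ := hx
    exact (i.forcesLe_iff hQ.order_name hx hx hp).2
      (hQ.refl p hp x hx ((i.forcesMem_iff hx hQ.under_name hp).1 h))
  trans := by
    intro p hp x y z hx hy hz h₁ h₂ h₃ h₄ h₅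
    replace hp := i.exists_eq hp
    obtain ⟨p, hp, rfl⟩ := hp
    replace hx := i.exists_name_eq hx
    obtain ⟨x, hx, rfl⟩ := hx
    replace hy := i.exists_name_eq hy
    obtain ⟨y, hy, rfl⟩ := hy
    replace hz := i.exists_name_eq hz
    obtain ⟨z, hz, rfl⟩ := hz
    exact (i.forcesLe_iff hQ.order_name hx hz hp).2 (hQ.trans p hp x y z hx hy hz
      ((i.forcesMem_iff hx hQ.under_name hp).1 h₁) ((i.forcesMem_iff hy hQ.under_name hp).1 h₂)
      ((i.forcesMem_iff hz hQ.under_name hp).1 h₃) ((i.forcesLe_iff hQ.order_name hx hy hp).1 h₄)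
      ((i.forcesLe_iff hQ.order_name hy hz hp).1 h₅))

theorem isMaxAntichain (i : NotionIso σ τ N N') {A : Set ZFSet.{u}} (hA : IsMaxAntichain N A) :
    IsMaxAntichain N' (rearrCond σ '' A) where
  subset := by
    rintro _ ⟨a, ha, rfl⟩
    exact i.map_mem a (hA.subset ha)
  antichain := by
    rintro _ ⟨a, ha, rfl⟩ _ ⟨b, hb, rfl⟩ q hq hqa hqb
    replace hq := i.exists_eq hq
    obtain ⟨q, hq, rfl⟩ := hq
    rw [hA.antichain a ha b hb q hq ((i.le_iff _ hq _ (hA.subset ha)).1 hqa)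
      ((i.le_iff _ hq _ (hA.subset hb)).1 hqb)]
  maximal := by
    intro p hp
    replace hp := i.exists_eq hp
    obtain ⟨p, hp, rfl⟩ := hp
    obtain ⟨a, ha, q, hq, hqp, hqa⟩ := hA.maximal p hp
    exact ⟨_, ⟨a, ha, rfl⟩, _, i.map_mem q hq, (i.le_iff _ hq _ hp).2 hqp,
      (i.le_iff _ hq _ (hA.subset ha)).2 hqa⟩

theorem isCanonicalElt (i : NotionIso σ τ N N') {Q : PosetName.{u}} (hQ : IsName N Q.under)
    {v : ZFSet.{u}} (h : IsCanonicalElt N Q v) :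
    IsCanonicalElt N' (rearrPosetName σ Q) (rearrName σ v) := by
  obtain ⟨A, f, hA, hf, hv⟩ := h
  refine ⟨_, fun a => rearrName σ (f (rearrCond τ a)), i.isMaxAntichain hA, ?_, fun w => ?_⟩
  · rintro _ ⟨a, ha, rfl⟩
    obtain ⟨⟨r, hr⟩, hm⟩ := hf a ha
    have ha' := hA.subset ha
    beta_reduce
    rw [i.left_inv a ha']
    exact ⟨⟨_, pair_mem_rearrName.2 ⟨_, r, hr, rfl, rfl⟩⟩,
      i.forcesMem_map (hQ.left hr) hQ ha' hm⟩
  · rw [mem_rearrName]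
    constructor
    · rintro ⟨z, q, hzq, rfl⟩
      obtain ⟨a, ha, z', r, q', hz, hq, hqa, hqr, e⟩ := (hv _).1 hzq
      obtain ⟨rfl, rfl⟩ := pair_injective e
      obtain ⟨⟨s, hs⟩, -⟩ := hf a ha
      have ha' := hA.subset ha
      refine ⟨_, ⟨a, ha, rfl⟩, _, _, _, ?_, i.map_mem q hq, (i.le_iff _ hq _ ha').2 hqa,
        (i.le_iff _ hq _ ((hQ.left hs).right hz)).2 hqr, rfl⟩
      beta_reduce
      rw [i.left_inv a ha']
      exact pair_mem_rearrName.2 ⟨z, r, hz, rfl, rfl⟩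
    · rintro ⟨_, ⟨a, ha, rfl⟩, z, r, q, hz, hq, hqa, hqr, rfl⟩
      obtain ⟨⟨s, hs⟩, -⟩ := hf a ha
      have ha' := hA.subset ha
      beta_reduce at hz
      rw [i.left_inv a ha'] at hz
      replace hz := pair_mem_rearrName.1 hz
      obtain ⟨z, r, hz, rfl, rfl⟩ := hz
      replace hq := i.exists_eq hq
      obtain ⟨q, hq, rfl⟩ := hq
      exact ⟨z, q, (hv _).2 ⟨a, ha, z, r, q, hz, hq, (i.le_iff _ hq _ ha').1 hqa,
        (i.le_iff _ hq _ ((hQ.left hs).right hz)).1 hqr, rfl⟩, rfl⟩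

end NotionIso

/-! ### Finite partial functions -/

theorem isFinPartial_empty : IsFinPartial (∅ : ZFSet.{u}) where
  finite := by simp
  pairs _ he := absurd he (notMem_empty _)
  functional ξ v w hv := absurd hv (notMem_empty _)

theorem val_cres {p v : ZFSet.{u}} {ξ : Ordinal.{u}} {B : Set Ordinal.{u}} :
    Val (cres p B) ξ v ↔ Val p ξ v ∧ ξ ∈ B := by
  rw [Val, cres, ZFSet.mem_sep]
  refine and_congr_right fun _ => ⟨?_, fun h => ⟨ξ, h, v, rfl⟩⟩
  rintro ⟨ζ, hζ, w, e⟩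
  obtain ⟨e₁, -⟩ := pair_injective e
  rwa [toZFSet_injective e₁]

theorem IsFinPartial.cres {p : ZFSet.{u}} (hp : IsFinPartial p) (B : Set Ordinal.{u}) :
    IsFinPartial (cres p B) where
  finite := hp.finite.subset fun _ he => (ZFSet.mem_sep.1 he).1
  pairs e he := hp.pairs e (ZFSet.mem_sep.1 he).1
  functional ξ v w hv hw := hp.functional ξ v w (val_cres.1 hv).1 (val_cres.1 hw).1

theorem ext_of_val {p q : ZFSet.{u}} (hp : ∀ e ∈ p, ∃ (ξ : Ordinal.{u}) (v : ZFSet.{u}),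
    e = pair ξ.toZFSet v) (hq : ∀ e ∈ q, ∃ (ξ : Ordinal.{u}) (v : ZFSet.{u}),
    e = pair ξ.toZFSet v) (h : ∀ ξ v, Val p ξ v ↔ Val q ξ v) : p = q := by
  ext e
  constructor
  · intro he
    obtain ⟨ξ, v, rfl⟩ := hp e he
    exact (h ξ v).1 he
  · intro he
    obtain ⟨ξ, v, rfl⟩ := hq e he
    exact (h ξ v).2 he

theorem rearrCond_pairs (σ : PMap.{u}) (p : ZFSet.{u}) : ∀ e ∈ rearrCond σ p,
    ∃ (ξ : Ordinal.{u}) (v : ZFSet.{u}), e = pair ξ.toZFSet v := by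
  intro e he
  obtain ⟨_, ξ', v, -, -, rfl⟩ := mem_rearrCond.1 he
  exact ⟨ξ', _, rfl⟩

theorem IsFinPartial.rearrCond {σ : PMap.{u}} (hσ : ∀ ξ ζ η, η ∈ σ ξ → η ∈ σ ζ → ξ = ζ)
    {p : ZFSet.{u}} (hp : IsFinPartial p) : IsFinPartial (rearrCond σ p) where
  finite := by
    classical
    choose! f g hfg using hp.pairs
    refine (hp.finite.image fun e =>
      pair ((σ (f e)).getD 0).toZFSet (rearrName σ (g e))).subset fun e he => ?_
    obtain ⟨ξ, ξ', v, hξ, hv, rfl⟩ := mem_rearrCond.1 he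
    refine ⟨_, hv, ?_⟩
    obtain ⟨e₁, e₂⟩ := pair_injective (hfg _ hv)
    beta_reduce
    rw [← toZFSet_injective e₁, ← e₂, Option.mem_def.1 hξ, Option.getD_some]
  pairs := rearrCond_pairs σ p
  functional ξ' v' w' hv' hw' := by
    obtain ⟨ξ, v, hξ, hv, rfl⟩ := val_rearrCond.1 hv'
    obtain ⟨ζ, w, hζ, hw, rfl⟩ := val_rearrCond.1 hw'
    obtain rfl := hσ _ _ _ hξ hζ
    rw [hp.functional _ _ _ hv hw]

theorem rearrCond_cres {σ : PMap.{u}} (hσ : ∀ ξ ζ η, η ∈ σ ξ → η ∈ σ ζ → ξ = ζ)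
    (p : ZFSet.{u}) (B : Set Ordinal.{u}) :
    rearrCond σ (cres p B) = cres (rearrCond σ p) (σ.image B) := by
  refine ext_of_val (rearrCond_pairs σ _)
    (fun e he => rearrCond_pairs σ p e (ZFSet.mem_sep.1 he).1) fun ξ' v' => ?_
  rw [val_cres, val_rearrCond, val_rearrCond]
  constructor
  · rintro ⟨ξ, v, hξ, hv, rfl⟩
    obtain ⟨hv, hB⟩ := val_cres.1 hv
    exact ⟨⟨ξ, v, hξ, hv, rfl⟩, ξ, hB, hξ⟩
  · rintro ⟨⟨ξ, v, hξ, hv, rfl⟩, ζ, hB, hζ⟩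
    obtain rfl := hσ _ _ _ hξ hζ
    exact ⟨ξ, v, hξ, val_cres.2 ⟨hv, hB⟩, rfl⟩

/-! ### The conditions of an iteration, recovered from its memory function and iterands -/

/-- The forcing notion of finite partial functions on `X` whose value at `ξ` is a canonical
`N ξ`-name for an element of `U ξ`. -/
def notionOver (m : Ordinal.{u} → Set Ordinal.{u}) (U : Ordinal.{u} → PosetName.{u})
    (N : Ordinal.{u} → Notion.{u}) (X : Set Ordinal.{u}) : Notion.{u} where
  carrier := {p | IsFinPartial p ∧ cdom p ⊆ X ∧ ∀ ξ v, Val p ξ v → IsCanonicalElt (N ξ) (U ξ) v}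
  le q p := (IsFinPartial q ∧ cdom q ⊆ X ∧ ∀ ξ v, Val q ξ v → IsCanonicalElt (N ξ) (U ξ) v) ∧
    (IsFinPartial p ∧ cdom p ⊆ X ∧ ∀ ξ v, Val p ξ v → IsCanonicalElt (N ξ) (U ξ) v) ∧
    cdom p ⊆ cdom q ∧
    ∀ ξ v w, Val p ξ v → Val q ξ w → ForcesLe (N ξ) (U ξ) w v (cres q (m ξ))

section notionOver

variable {m m' : Ordinal.{u} → Set Ordinal.{u}} {U U' : Ordinal.{u} → PosetName.{u}}
  {N N' : Ordinal.{u} → Notion.{u}} {X : Set Ordinal.{u}}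

theorem mem_notionOver {p : ZFSet.{u}} : p ∈ (notionOver m U N X).carrier ↔ IsFinPartial p ∧
    cdom p ⊆ X ∧ ∀ ξ v, Val p ξ v → IsCanonicalElt (N ξ) (U ξ) v := Iff.rfl

theorem notionOver_le {q p : ZFSet.{u}} : (notionOver m U N X).le q p ↔
    q ∈ (notionOver m U N X).carrier ∧ p ∈ (notionOver m U N X).carrier ∧ cdom p ⊆ cdom q ∧
    ∀ ξ v w, Val p ξ v → Val q ξ w → ForcesLe (N ξ) (U ξ) w v (cres q (m ξ)) := Iff.rfl

theorem empty_mem_notionOver : ∅ ∈ (notionOver m U N X).carrier :=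
  ⟨isFinPartial_empty, fun _ ⟨_, hv⟩ => absurd hv (notMem_empty _),
    fun _ _ hv => absurd hv (notMem_empty _)⟩

theorem cres_mem_notionOver {p : ZFSet.{u}} (hp : p ∈ (notionOver m U N X).carrier)
    (B : Set Ordinal.{u}) : cres p B ∈ (notionOver m U N B).carrier :=
  ⟨hp.1.cres B, fun _ ⟨_, hv⟩ => (val_cres.1 hv).2, fun ξ v hv => hp.2.2 ξ v (val_cres.1 hv).1⟩

theorem notionOver_congr (hm : ∀ ξ ∈ X, m ξ = m' ξ) (hU : ∀ ξ ∈ X, U ξ = U' ξ)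
    (hN : ∀ ξ ∈ X, N ξ = N' ξ) : notionOver m U N X = notionOver m' U' N' X := by
  have hc : (notionOver m U N X).carrier = (notionOver m' U' N' X).carrier := by
    ext p
    refine and_congr_right fun _ => and_congr_right fun hX => forall₃_congr fun ξ v hv => ?_
    rw [hU ξ (hX ⟨v, hv⟩), hN ξ (hX ⟨v, hv⟩)]
  refine Notion.ext hc ?_
  ext q p
  rw [notionOver_le, notionOver_le, hc]
  refine and_congr_right fun _ => and_congr_right fun hp => and_congr_right fun _ =>
    forall₄_congr fun ξ v w hv => ?_
  have hξ := (mem_notionOver.1 hp).2.1 ⟨v, hv⟩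
  rw [hU ξ hξ, hN ξ hξ, hm ξ hξ]

end notionOver

open Classical in
/-- The restriction to `m ξ` of an iteration with memory `m` and iterands `U`, defined by recursion
on `ξ`. -/
noncomputable def localNotion (m : Ordinal.{u} → Set Ordinal.{u})
    (U : Ordinal.{u} → PosetName.{u}) (ξ : Ordinal.{u}) : Notion.{u} :=
  notionOver m U (fun ζ => if _h : ζ < ξ then localNotion m U ζ else ⟨∅, fun _ _ => False⟩) (m ξ)
termination_by ξ

theorem localNotion_eq {m : Ordinal.{u} → Set Ordinal.{u}} (U : Ordinal.{u} → PosetName.{u})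
    {ξ : Ordinal.{u}} (h : m ξ ⊆ Iio ξ) :
    localNotion m U ξ = notionOver m U (localNotion m U) (m ξ) := by
  rw [localNotion]
  exact notionOver_congr (fun _ _ => rfl) (fun _ _ => rfl) fun ζ hζ => dif_pos (h hζ)

theorem localNotion_congr {m m' : Ordinal.{u} → Set Ordinal.{u}}
    {U U' : Ordinal.{u} → PosetName.{u}} {Z : Set Ordinal.{u}} (hZ : ∀ ξ ∈ Z, m ξ ⊆ Z ∩ Iio ξ)
    (hm : ∀ ξ ∈ Z, m ξ = m' ξ) (hU : ∀ ξ ∈ Z, U ξ = U' ξ) :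
    ∀ ξ ∈ Z, localNotion m U ξ = localNotion m' U' ξ := by
  intro ξ
  induction ξ using WellFoundedLT.induction with
  | ind ξ ih =>
    intro hξ
    rw [localNotion_eq U fun ζ hζ => (hZ ξ hξ hζ).2,
      localNotion_eq U' fun ζ hζ => (hZ ξ hξ (hm ξ hξ ▸ hζ)).2, ← hm ξ hξ]
    exact notionOver_congr (fun ζ hζ => hm ζ (hZ ξ hξ hζ).1) (fun ζ hζ => hU ζ (hZ ξ hξ hζ).1)
      fun ζ hζ => ih ζ (hZ ξ hξ hζ).2 (hZ ξ hξ hζ).1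

theorem IterData.restrict_notion {R : IterData.{u}} {m : Ordinal.{u} → Set Ordinal.{u}}
    {U : Ordinal.{u} → PosetName.{u}} {N : Ordinal.{u} → Notion.{u}}
    (h : R.notion = notionOver m U N R.dom) {Z : Set Ordinal.{u}} (hZ : Z ⊆ R.dom) :
    (R.restrict Z).notion = notionOver m U N Z := by
  have hc : ∀ p, p ∈ R.carrier ↔ p ∈ (notionOver m U N R.dom).carrier := fun p => by
    rw [← h]; rfl
  have hl : ∀ q p, R.le q p ↔ (notionOver m U N R.dom).le q p := fun q p => by
    rw [← h]; rfl
  have hc' : ∀ p, p ∈ (R.restrict Z).notion.carrier ↔ p ∈ (notionOver m U N Z).carrier := by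
    intro p
    constructor
    · rintro ⟨hp, hpZ⟩
      obtain ⟨h₁, -, h₂⟩ := (hc p).1 hp
      exact ⟨h₁, hpZ, h₂⟩
    · rintro ⟨h₁, hpZ, h₂⟩
      exact ⟨(hc p).2 ⟨h₁, hpZ.trans hZ, h₂⟩, hpZ⟩
  refine Notion.ext (Set.ext hc') ?_
  ext q p
  constructor
  · rintro ⟨hle, hq, hp⟩
    obtain ⟨h₁, h₂, h₃⟩ := notionOver_le.1 ((hl q p).1 hle)
    exact notionOver_le.2 ⟨⟨h₁.1, hq, h₁.2.2⟩, ⟨h₂.1, hp, h₂.2.2⟩, h₃⟩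
  · intro hle
    obtain ⟨h₁, h₂, h₃⟩ := notionOver_le.1 hle
    exact ⟨(hl q p).2 (notionOver_le.2 ⟨⟨h₁.1, h₁.2.1.trans hZ, h₁.2.2⟩,
      ⟨h₂.1, h₂.2.1.trans hZ, h₂.2.2⟩, h₃⟩), h₁.2.1, h₂.2.1⟩

namespace IsRMI

variable {R : IterData.{u}}

theorem notion_eq_notionOver (hR : IsRMI R) :
    R.notion = notionOver R.mem R.iter (fun ξ => (R.restrict (R.mem ξ)).notion) R.dom := by
  refine Notion.ext (Set.ext hR.mem_carrier) ?_
  ext q p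
  rw [notionOver_le, mem_notionOver, mem_notionOver, ← hR.mem_carrier, ← hR.mem_carrier]
  exact hR.le_iff q p

theorem restrict_mem_notion (hR : IsRMI R) :
    ∀ ξ ∈ R.dom, (R.restrict (R.mem ξ)).notion = localNotion R.mem R.iter ξ := by
  intro ξ
  induction ξ using WellFoundedLT.induction with
  | ind ξ ih =>
    intro hξ
    have hm := hR.mem_subset ξ hξ
    rw [IterData.restrict_notion hR.notion_eq_notionOver fun ζ hζ => (hm hζ).1,
      localNotion_eq R.iter fun ζ hζ => (hm hζ).2]
    exact notionOver_congr (fun _ _ => rfl) (fun _ _ => rfl) fun ζ hζ =>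
      ih ζ (hm hζ).2 (hm hζ).1

theorem notion_eq (hR : IsRMI R) :
    R.notion = notionOver R.mem R.iter (localNotion R.mem R.iter) R.dom := by
  rw [hR.notion_eq_notionOver]
  exact notionOver_congr (fun _ _ => rfl) (fun _ _ => rfl) hR.restrict_mem_notion

end IsRMI

theorem IterData.restrict_mem_notion {R : IterData.{u}}
    (hm : ∀ ξ ∈ R.dom, R.mem ξ ⊆ R.dom ∩ Iio ξ)
    (h : R.notion = notionOver R.mem R.iter (localNotion R.mem R.iter) R.dom) :
    ∀ ξ ∈ R.dom, (R.restrict (R.mem ξ)).notion = localNotion R.mem R.iter ξ := fun ξ hξ => by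
  rw [IterData.restrict_notion h fun ζ hζ => (hm ξ hξ hζ).1,
    localNotion_eq R.iter fun ζ hζ => (hm ξ hξ hζ).2]

/-! ### Rearrangements of iterations -/

/-- The hypotheses under which the isomorphisms `N ξ ≅ N' (σ ξ)` for `ξ ∈ Z` lift to the iterations
over `Z` and `Z'`. -/
structure LocalIso (σ τ : PMap.{u}) (m m' : Ordinal.{u} → Set Ordinal.{u})
    (U U' : Ordinal.{u} → PosetName.{u}) (N N' : Ordinal.{u} → Notion.{u})
    (Z Z' : Set Ordinal.{u}) : Prop where
  inv : ∀ ξ ξ', ξ' ∈ σ ξ ↔ ξ ∈ τ ξ'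
  maps : ∀ ξ ∈ Z, ∃ ξ' ∈ Z', ξ' ∈ σ ξ
  surj : ∀ ξ' ∈ Z', ∃ ξ ∈ Z, ξ' ∈ σ ξ
  iso : ∀ ξ ∈ Z, ∀ ξ' ∈ σ ξ, NotionIso σ τ (N ξ) (N' ξ')
  loc : ∀ ξ ∈ Z, N ξ = notionOver m U N (m ξ)
  loc' : ∀ ξ' ∈ Z', N' ξ' = notionOver m' U' N' (m' ξ')
  mem_dom : ∀ ξ ∈ Z, m ξ ⊆ σ.Dom
  mem_eq : ∀ ξ ∈ Z, ∀ ξ' ∈ σ ξ, m' ξ' = σ.image (m ξ)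
  iter_eq : ∀ ξ ∈ Z, ∀ ξ' ∈ σ ξ, U' ξ' = rearrPosetName σ (U ξ)
  under_name : ∀ ξ ∈ Z, IsName (N ξ) (U ξ).under
  order_name : ∀ ξ ∈ Z, IsName (N ξ) (U ξ).order

namespace LocalIso

variable {σ τ : PMap.{u}} {m m' : Ordinal.{u} → Set Ordinal.{u}}
  {U U' : Ordinal.{u} → PosetName.{u}} {N N' : Ordinal.{u} → Notion.{u}} {Z Z' : Set Ordinal.{u}}

theorem inj (i : LocalIso σ τ m m' U U' N N' Z Z') :
    ∀ ξ ζ η, η ∈ σ ξ → η ∈ σ ζ → ξ = ζ := fun ξ ζ η h₁ h₂ =>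
  Option.mem_unique ((i.inv ξ η).1 h₁) ((i.inv ζ η).1 h₂)

theorem mem_of_mem (i : LocalIso σ τ m m' U U' N N' Z Z') {ξ ξ' : Ordinal.{u}} (hξ : ξ ∈ Z)
    (h : ξ' ∈ σ ξ) : ξ' ∈ Z' := by
  obtain ⟨η, hη, h'⟩ := i.maps ξ hξ
  rwa [Option.mem_unique h h']

theorem mem_of_mem' (i : LocalIso σ τ m m' U U' N N' Z Z') {ξ ξ' : Ordinal.{u}} (hξ : ξ' ∈ Z')
    (h : ξ' ∈ σ ξ) : ξ ∈ Z := by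
  obtain ⟨η, hη, h'⟩ := i.surj ξ' hξ
  rwa [i.inj _ _ _ h h']

theorem symm (i : LocalIso σ τ m m' U U' N N' Z Z') : LocalIso τ σ m' m U' U N' N Z' Z where
  inv ξ' ξ := (i.inv ξ ξ').symm
  maps ξ' h := by
    obtain ⟨ξ, hξ, h'⟩ := i.surj ξ' h
    exact ⟨ξ, hξ, (i.inv _ _).1 h'⟩
  surj ξ h := by
    obtain ⟨ξ', hξ, h'⟩ := i.maps ξ h
    exact ⟨ξ', hξ, (i.inv _ _).1 h'⟩
  iso ξ' h ξ hξ := (i.iso ξ (i.mem_of_mem' h ((i.inv _ _).2 hξ)) ξ' ((i.inv _ _).2 hξ)).symm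
  loc := i.loc'
  loc' := i.loc
  mem_dom ξ' h ζ' hζ' := by
    obtain ⟨ξ, hξ, h'⟩ := i.surj ξ' h
    rw [i.mem_eq ξ hξ ξ' h'] at hζ'
    obtain ⟨ζ, -, hζ⟩ := hζ'
    exact ⟨ζ, (i.inv _ _).1 hζ⟩
  mem_eq ξ' h ξ hξ := by
    have hξ' := (i.inv _ _).2 hξ
    have hZ := i.mem_of_mem' h hξ'
    rw [i.mem_eq ξ hZ ξ' hξ']
    ext ζ
    constructor
    · intro hζ
      obtain ⟨ζ', h'⟩ := i.mem_dom ξ hZ hζ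
      exact ⟨ζ', ⟨ζ, hζ, h'⟩, (i.inv _ _).1 h'⟩
    · rintro ⟨ζ', ⟨η, hη, h₁⟩, h₂⟩
      rwa [i.inj ζ η ζ' ((i.inv _ _).2 h₂) h₁]
  iter_eq ξ' h ξ hξ := by
    have hξ' := (i.inv _ _).2 hξ
    have hZ := i.mem_of_mem' h hξ'
    rw [i.iter_eq ξ hZ ξ' hξ']
    have j := i.iso ξ hZ ξ' hξ'
    ext1
    · exact (j.rearrName_left_inv (i.under_name ξ hZ)).symm
    · exact (j.rearrName_left_inv (i.order_name ξ hZ)).symm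
  under_name ξ' h := by
    obtain ⟨ξ, hξ, h'⟩ := i.surj ξ' h
    rw [i.iter_eq ξ hξ ξ' h']
    exact (i.iso ξ hξ ξ' h').isName (i.under_name ξ hξ)
  order_name ξ' h := by
    obtain ⟨ξ, hξ, h'⟩ := i.surj ξ' h
    rw [i.iter_eq ξ hξ ξ' h']
    exact (i.iso ξ hξ ξ' h').isName (i.order_name ξ hξ)

theorem isName_val (i : LocalIso σ τ m m' U U' N N' Z Z') {p v : ZFSet.{u}} {ξ : Ordinal.{u}}
    (hp : p ∈ (notionOver m U N Z).carrier) (hv : Val p ξ v) : IsName (N ξ) v :=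
  (hp.2.2 ξ v hv).isName (i.under_name ξ (hp.2.1 ⟨v, hv⟩))

theorem map_mem (i : LocalIso σ τ m m' U U' N N' Z Z') {p : ZFSet.{u}}
    (hp : p ∈ (notionOver m U N Z).carrier) :
    rearrCond σ p ∈ (notionOver m' U' N' Z').carrier := by
  refine ⟨hp.1.rearrCond i.inj, ?_, ?_⟩
  · rintro ξ' ⟨v', hv'⟩
    obtain ⟨ξ, v, hξ, hv, rfl⟩ := val_rearrCond.1 hv'
    exact i.mem_of_mem (hp.2.1 ⟨v, hv⟩) hξ
  · intro ξ' v' hv'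
    obtain ⟨ξ, v, hξ, hv, rfl⟩ := val_rearrCond.1 hv'
    have hZ := hp.2.1 ⟨v, hv⟩
    rw [i.iter_eq ξ hZ ξ' hξ]
    exact (i.iso ξ hZ ξ' hξ).isCanonicalElt (i.under_name ξ hZ) (hp.2.2 ξ v hv)

theorem left_inv (i : LocalIso σ τ m m' U U' N N' Z Z') {p : ZFSet.{u}}
    (hp : p ∈ (notionOver m U N Z).carrier) : rearrCond τ (rearrCond σ p) = p := by
  refine ext_of_val (rearrCond_pairs τ _) hp.1.pairs fun ξ v => ?_
  rw [val_rearrCond]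
  constructor
  · rintro ⟨ξ', v', hξ', hv', rfl⟩
    obtain ⟨ζ, w, hζ, hw, rfl⟩ := val_rearrCond.1 hv'
    obtain rfl := i.inj _ _ _ hζ ((i.inv _ _).2 hξ')
    rwa [(i.iso ζ (hp.2.1 ⟨w, hw⟩) ξ' hζ).rearrName_left_inv (i.isName_val hp hw)]
  · intro hv
    have hZ := hp.2.1 ⟨v, hv⟩
    obtain ⟨ξ', -, hξ'⟩ := i.maps ξ hZ
    exact ⟨ξ', _, (i.inv _ _).1 hξ', val_rearrCond.2 ⟨ξ, v, hξ', hv, rfl⟩,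
      ((i.iso ξ hZ ξ' hξ').rearrName_left_inv (i.isName_val hp hv)).symm⟩

theorem map_le (i : LocalIso σ τ m m' U U' N N' Z Z') {q p : ZFSet.{u}}
    (h : (notionOver m U N Z).le q p) :
    (notionOver m' U' N' Z').le (rearrCond σ q) (rearrCond σ p) := by
  obtain ⟨hq, hp, hd, hf⟩ := notionOver_le.1 h
  refine notionOver_le.2 ⟨i.map_mem hq, i.map_mem hp, ?_, ?_⟩
  · rintro ξ' ⟨v', hv'⟩
    obtain ⟨ξ, v, hξ, hv, rfl⟩ := val_rearrCond.1 hv'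
    obtain ⟨w, hw⟩ := hd ⟨v, hv⟩
    exact ⟨_, val_rearrCond.2 ⟨ξ, w, hξ, hw, rfl⟩⟩
  · intro ξ' v' w' hv' hw'
    obtain ⟨ξ, v, hξ, hv, rfl⟩ := val_rearrCond.1 hv'
    obtain ⟨ζ, w, hζ, hw, rfl⟩ := val_rearrCond.1 hw'
    obtain rfl := i.inj _ _ _ hξ hζ
    have hZ := hp.2.1 ⟨v, hv⟩
    rw [i.iter_eq ξ hZ ξ' hξ, i.mem_eq ξ hZ ξ' hξ, ← rearrCond_cres i.inj,
      (i.iso ξ hZ ξ' hξ).forcesLe_iff (i.order_name ξ hZ) (i.isName_val hq hw)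
      (i.isName_val hp hv) (by rw [i.loc ξ hZ]; exact cres_mem_notionOver hq _)]
    exact hf ξ v w hv hw

theorem notionIso (i : LocalIso σ τ m m' U U' N N' Z Z') :
    NotionIso σ τ (notionOver m U N Z) (notionOver m' U' N' Z') where
  empty_mem := empty_mem_notionOver
  map_mem _ := i.map_mem
  inv_mem _ := i.symm.map_mem
  left_inv _ := i.left_inv
  right_inv _ := i.symm.left_inv
  le_iff q hq p hp := by
    refine ⟨fun h => ?_, i.map_le⟩
    have := i.symm.map_le h
    rwa [i.left_inv hq, i.left_inv hp] at this

end LocalIso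

/-- A bijection of index sets which transfers the memory functions and the iterands gives
isomorphisms of the restrictions to memory sets. -/
theorem notionIso_localNotion {σ τ : PMap.{u}} {m m' : Ordinal.{u} → Set Ordinal.{u}}
    {U U' : Ordinal.{u} → PosetName.{u}} {X X' : Set Ordinal.{u}}
    (inv : ∀ ξ ξ', ξ' ∈ σ ξ ↔ ξ ∈ τ ξ') (hX : X ⊆ σ.Dom)
    (hmaps : ∀ ξ ∈ X, ∀ ξ' ∈ σ ξ, ξ' ∈ X')
    (hm : ∀ ξ ∈ X, m ξ ⊆ X ∩ Iio ξ) (hm' : ∀ ξ' ∈ X', m' ξ' ⊆ Iio ξ')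
    (mem_eq : ∀ ξ ∈ X, ∀ ξ' ∈ σ ξ, m' ξ' = σ.image (m ξ))
    (iter_eq : ∀ ξ ∈ X, ∀ ξ' ∈ σ ξ, U' ξ' = rearrPosetName σ (U ξ))
    (under_name : ∀ ξ ∈ X, IsName (localNotion m U ξ) (U ξ).under)
    (order_name : ∀ ξ ∈ X, IsName (localNotion m U ξ) (U ξ).order) :
    ∀ ξ ∈ X, ∀ ξ' ∈ σ ξ, NotionIso σ τ (localNotion m U ξ) (localNotion m' U' ξ') := by
  intro ξ
  induction ξ using WellFoundedLT.induction with
  | ind ξ ih =>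
    intro hξ ξ' hξ'
    have hs : ∀ ζ ∈ m ξ, ζ ∈ X := fun ζ hζ => (hm ξ hξ hζ).1
    rw [localNotion_eq U fun ζ hζ => (hm ξ hξ hζ).2, localNotion_eq U' (hm' ξ' (hmaps ξ hξ ξ' hξ')),
      mem_eq ξ hξ ξ' hξ']
    exact LocalIso.notionIso
      { inv := inv
        maps := fun ζ hζ => by
          obtain ⟨ζ', h⟩ := hX (hs ζ hζ)
          exact ⟨ζ', ⟨ζ, hζ, h⟩, h⟩
        surj := fun ζ' ⟨ζ, hζ, h⟩ => ⟨ζ, hζ, h⟩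
        iso := fun ζ hζ => ih ζ (hm ξ hξ hζ).2 (hs ζ hζ)
        loc := fun ζ hζ => localNotion_eq U fun η hη => (hm ζ (hs ζ hζ) hη).2
        loc' := fun ζ' ⟨ζ, hζ, h⟩ => localNotion_eq U' (hm' ζ' (hmaps ζ (hs ζ hζ) ζ' h))
        mem_dom := fun ζ hζ η hη => hX (hm ζ (hs ζ hζ) hη).1
        mem_eq := fun ζ hζ => mem_eq ζ (hs ζ hζ)
        iter_eq := fun ζ hζ => iter_eq ζ (hs ζ hζ)
        under_name := fun ζ hζ => under_name ζ (hs ζ hζ)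
        order_name := fun ζ hζ => order_name ζ (hs ζ hζ) }

/-! ### Partial functions -/

namespace PMap

theorem mem_comp {σ π : PMap.{u}} {a c : Ordinal.{u}} :
    c ∈ σ.comp π a ↔ ∃ b, b ∈ π a ∧ c ∈ σ b := Option.bind_eq_some_iff

theorem image_comp (σ π : PMap.{u}) (s : Set Ordinal.{u}) :
    (σ.comp π).image s = σ.image (π.image s) := by
  ext c
  constructor
  · rintro ⟨a, ha, hc⟩
    obtain ⟨b, hb, hc⟩ := mem_comp.1 hc
    exact ⟨b, ⟨a, ha, hb⟩, hc⟩
  · rintro ⟨b, ⟨a, ha, hb⟩, hc⟩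
    exact ⟨a, ha, mem_comp.2 ⟨b, hb, hc⟩⟩

theorem comp_assoc (σ τ π : PMap.{u}) : (σ.comp τ).comp π = σ.comp (τ.comp π) := by
  funext a
  exact (Option.bind_assoc _ _ _).symm

theorem comp_congr {σ σ' π : PMap.{u}} (h : ∀ b ∈ π.ran, σ b = σ' b) : σ.comp π = σ'.comp π := by
  funext a
  simp only [comp]
  cases e : π a with
  | none => rfl
  | some b => exact h b ⟨a, e⟩

theorem image_congr {σ σ' : PMap.{u}} {s : Set Ordinal.{u}} (h : ∀ a ∈ s, σ a = σ' a) :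
    σ.image s = σ'.image s := by
  ext b
  exact exists_congr fun a => and_congr_right fun ha => by rw [h a ha]

theorem image_mono (σ : PMap.{u}) {s t : Set Ordinal.{u}} (h : s ⊆ t) : σ.image s ⊆ σ.image t :=
  fun _ ⟨a, ha, hb⟩ => ⟨a, h ha, hb⟩

theorem image_subset_ran (σ : PMap.{u}) (s : Set Ordinal.{u}) : σ.image s ⊆ σ.ran :=
  fun _ ⟨a, _, hb⟩ => ⟨a, hb⟩

open Classical in
/-- The inverse of an injective partial function. -/
noncomputable def inv (σ : PMap.{u}) : PMap.{u} := fun b =>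
  if h : ∃ a, b ∈ σ a then some h.choose else none

theorem mem_inv {σ : PMap.{u}} (hσ : ∀ a b c, c ∈ σ a → c ∈ σ b → a = b) (a b : Ordinal.{u}) :
    b ∈ σ a ↔ a ∈ σ.inv b := by
  unfold inv
  split_ifs with h
  · rw [Option.mem_some_iff]
    exact ⟨fun hb => hσ _ _ _ h.choose_spec hb, fun e => e ▸ h.choose_spec⟩
  · exact iff_of_false (fun hb => h ⟨a, hb⟩) (Option.not_mem_none a)

end PMap

theorem IsAcceptable.comp {σ π : PMap.{u}} {X x : Set Ordinal.{u}}
    {b : Ordinal.{u} → Set Ordinal.{u}} (hπ : IsAcceptable π X b x) (hx : x ⊆ σ.Dom)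
    (hσ : ∀ ξ ζ η, η ∈ σ ξ → η ∈ σ ζ → ξ = ζ)
    (hlt : ∀ ξ ∈ X, ∀ ζ ∈ X, ζ ∈ b ξ → ∀ ξ' ∈ π ξ, ∀ ζ' ∈ π ζ, ∀ ξ'' ∈ σ ξ', ∀ ζ'' ∈ σ ζ',
      ζ'' < ξ'') : IsAcceptable (σ.comp π) X b (σ.image x) where
  bij :=
    { dom_eq := by
        rw [← hπ.bij.dom_eq]
        ext a
        constructor
        · rintro ⟨c, hc⟩
          obtain ⟨b, hb, -⟩ := PMap.mem_comp.1 hc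
          exact ⟨b, hb⟩
        · rintro ⟨b, hb⟩
          obtain ⟨c, hc⟩ := hx (hπ.bij.ran_eq ▸ ⟨a, hb⟩ : b ∈ x)
          exact ⟨c, PMap.mem_comp.2 ⟨b, hb, hc⟩⟩
      ran_eq := by
        rw [← hπ.bij.ran_eq]
        ext c
        constructor
        · rintro ⟨a, hc⟩
          obtain ⟨b, hb, hc⟩ := PMap.mem_comp.1 hc
          exact ⟨b, ⟨a, hb⟩, hc⟩
        · rintro ⟨b, ⟨a, hb⟩, hc⟩
          exact ⟨a, PMap.mem_comp.2 ⟨b, hb, hc⟩⟩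
      inj := by
        intro ξ ζ η h₁ h₂
        obtain ⟨a, ha, ha'⟩ := PMap.mem_comp.1 h₁
        obtain ⟨b, hb, hb'⟩ := PMap.mem_comp.1 h₂
        obtain rfl := hσ _ _ _ ha' hb'
        exact hπ.bij.inj _ _ _ ha hb }
  lt ξ hξ ζ hζ hb ξ'' hξ'' ζ'' hζ'' := by
    obtain ⟨ξ', h₁, h₁'⟩ := PMap.mem_comp.1 hξ''
    obtain ⟨ζ', h₂, h₂'⟩ := PMap.mem_comp.1 hζ''
    exact hlt ξ hξ ζ hζ hb ξ' h₁ ζ' h₂ ξ'' h₁' ζ'' h₂'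

/-! ### Restrictions of partition products -/

section restrict

variable {R : PPData.{u}} {Y : Set Ordinal.{u}} {ξ : Ordinal.{u}}

theorem PPData.restrict_mem (h : ξ ∈ Y) : (R.restrict Y).mem ξ = R.mem ξ := if_pos h

theorem PPData.restrict_iter (h : ξ ∈ Y) : (R.restrict Y).iter ξ = R.iter ξ := if_pos h

theorem PPData.restrict_index (h : ξ ∈ Y) : (R.restrict Y).index ξ = R.index ξ := if_pos h

theorem PPData.restrict_rmap (h : ξ ∈ Y) : (R.restrict Y).rmap ξ = R.rmap ξ := if_pos h

theorem PPData.restrict_dom : (R.restrict Y).dom = R.dom ∩ Y := rfl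

theorem PPData.restrict_restrict (R : PPData.{u}) {Y Z : Set Ordinal.{u}} (h : Z ⊆ Y) :
    (R.restrict Y).restrict Z = R.restrict Z := by
  apply PPData.ext
  · show R.dom ∩ Y ∩ Z = R.dom ∩ Z
    rw [Set.inter_assoc, Set.inter_eq_right.2 h]
  · funext ξ
    by_cases hZ : ξ ∈ Z
    · rw [PPData.restrict_mem hZ, PPData.restrict_mem hZ, PPData.restrict_mem (h hZ)]
    · exact (if_neg hZ).trans (if_neg hZ).symm
  · funext ξ
    by_cases hZ : ξ ∈ Z
    · rw [PPData.restrict_iter hZ, PPData.restrict_iter hZ, PPData.restrict_iter (h hZ)]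
    · exact (if_neg hZ).trans (if_neg hZ).symm
  · ext p
    exact ⟨fun ⟨⟨h₁, _⟩, h₂⟩ => ⟨h₁, h₂⟩, fun ⟨h₁, h₂⟩ => ⟨⟨h₁, h₂.trans h⟩, h₂⟩⟩
  · ext q p
    exact ⟨fun ⟨⟨h₁, _⟩, h₂⟩ => ⟨h₁, h₂⟩,
      fun ⟨h₁, h₂⟩ => ⟨⟨h₁, h₂.1.trans h, h₂.2.trans h⟩, h₂⟩⟩
  · funext ξ
    by_cases hZ : ξ ∈ Z
    · rw [PPData.restrict_index hZ, PPData.restrict_index hZ, PPData.restrict_index (h hZ)]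
    · exact (if_neg hZ).trans (if_neg hZ).symm
  · funext ξ
    by_cases hZ : ξ ∈ Z
    · rw [PPData.restrict_rmap hZ, PPData.restrict_rmap hZ, PPData.restrict_rmap (h hZ)]
    · exact (if_neg hZ).trans (if_neg hZ).symm

end restrict

theorem TransfersBase.comp {σ π : PMap.{u}} {A P R : PPData.{u}} {x : Set Ordinal.{u}}
    (h₁ : TransfersBase π A (P.restrict x)) (h₂ : TransfersBase σ P R)
    (hπ : ∀ ξ ∈ A.dom, ∀ ξ' ∈ π ξ, ξ' ∈ P.dom ∩ x) :
    TransfersBase (σ.comp π) A (R.restrict (σ.image x)) where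
  mem_eq ξ hξ ξ'' hξ'' := by
    obtain ⟨ξ', h, h'⟩ := PMap.mem_comp.1 hξ''
    have hx := hπ ξ hξ ξ' h
    have hx' : ξ'' ∈ σ.image x := ⟨ξ', hx.2, h'⟩
    rw [PPData.restrict_mem hx', h₂.mem_eq ξ' hx.1 ξ'' h', PMap.image_comp,
      ← h₁.mem_eq ξ hξ ξ' h, PPData.restrict_mem hx.2]
  rmap_eq ξ hξ ξ'' hξ'' := by
    obtain ⟨ξ', h, h'⟩ := PMap.mem_comp.1 hξ''
    have hx := hπ ξ hξ ξ' h
    have hx' : ξ'' ∈ σ.image x := ⟨ξ', hx.2, h'⟩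
    rw [PPData.restrict_rmap hx', h₂.rmap_eq ξ' hx.1 ξ'' h', PMap.comp_assoc,
      ← h₁.rmap_eq ξ hξ ξ' h, PPData.restrict_rmap hx.2]
  index_eq ξ hξ ξ'' hξ'' := by
    obtain ⟨ξ', h, h'⟩ := PMap.mem_comp.1 hξ''
    have hx := hπ ξ hξ ξ' h
    have hx' : ξ'' ∈ σ.image x := ⟨ξ', hx.2, h'⟩
    rw [PPData.restrict_index hx', h₂.index_eq ξ' hx.1 ξ'' h', ← h₁.index_eq ξ hξ ξ' h,
      PPData.restrict_index hx.2]

/-! ### Grafts -/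

/-- `G` is an iteration on `R.dom ∪ σ[P.dom]` whose attached functions agree with those of `R`, and
with those of `P` transported along the injection `σ`, with inverse `τ`. -/
structure IsGraft (σ τ : PMap.{u}) (P R G : PPData.{u}) : Prop where
  inv : ∀ ξ ξ', ξ' ∈ σ ξ ↔ ξ ∈ τ ξ'
  dom_map : σ.Dom = P.dom
  lt : ∀ ξ ∈ P.dom, ∀ ζ ∈ P.mem ξ, ∀ ξ' ∈ σ ξ, ∀ ζ' ∈ σ ζ, ζ' < ξ'
  dom_eq : G.dom = R.dom ∪ σ.ran
  dom_bdd : BddAbove G.dom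
  mem_old : ∀ η ∈ R.dom, G.mem η = R.mem η
  iter_old : ∀ η ∈ R.dom, G.iter η = R.iter η
  index_old : ∀ η ∈ R.dom, G.index η = R.index η
  rmap_old : ∀ η ∈ R.dom, G.rmap η = R.rmap η
  base : TransfersBase σ P G
  iter_new : ∀ ξ ∈ P.dom, ∀ η ∈ σ ξ, G.iter η = rearrPosetName σ (P.iter ξ)
  mem_off : ∀ η ∉ G.dom, G.mem η = ∅
  iter_off : ∀ η ∉ G.dom, G.iter η = ⟨∅, ∅⟩
  index_off : ∀ η ∉ G.dom, G.index η = 0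
  rmap_off : ∀ η ∉ G.dom, G.rmap η = PMap.empty
  notion_eq : G.notion = notionOver G.mem G.iter (localNotion G.mem G.iter) G.dom

namespace IsGraft

variable {𝒜 : AlphabetData.{u}} {φ : Ordinal.{u} → Ordinal.{u} → PMap.{u}} {σ τ : PMap.{u}}
  {P R G : PPData.{u}}

theorem inj (g : IsGraft σ τ P R G) : ∀ ξ ζ η, η ∈ σ ξ → η ∈ σ ζ → ξ = ζ := fun ξ ζ η h₁ h₂ =>
  Option.mem_unique ((g.inv ξ η).1 h₁) ((g.inv ζ η).1 h₂)

theorem mem_dom (g : IsGraft σ τ P R G) {ξ η : Ordinal.{u}} (h : η ∈ σ ξ) : ξ ∈ P.dom :=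
  g.dom_map ▸ ⟨η, h⟩

theorem old_subset (g : IsGraft σ τ P R G) : R.dom ⊆ G.dom := g.dom_eq ▸ Set.subset_union_left

theorem ran_subset (g : IsGraft σ τ P R G) : σ.ran ⊆ G.dom := g.dom_eq ▸ Set.subset_union_right

theorem cases (g : IsGraft σ τ P R G) {η : Ordinal.{u}} (h : η ∈ G.dom) :
    η ∈ R.dom ∨ ∃ ξ ∈ P.dom, η ∈ σ ξ := by
  rw [g.dom_eq] at h
  exact h.imp_right fun ⟨ξ, hξ⟩ => ⟨ξ, g.mem_dom hξ, hξ⟩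

theorem mem_subset (g : IsGraft σ τ P R G) (hR : IsRMI R.toIterData) :
    ∀ η ∈ G.dom, G.mem η ⊆ G.dom ∩ Iio η := by
  intro η hη
  rcases g.cases hη with h | ⟨ξ, hξ, h⟩
  · rw [g.mem_old η h]
    exact (hR.mem_subset η h).trans (Set.inter_subset_inter_left _ g.old_subset)
  · rw [g.base.mem_eq ξ hξ η h]
    rintro ζ' ⟨ζ, hζ, hζ'⟩
    exact ⟨g.ran_subset ⟨ζ, hζ'⟩, g.lt ξ hξ ζ hζ η h ζ' hζ'⟩

theorem localNotion_old (g : IsGraft σ τ P R G) (hR : IsRMI R.toIterData) :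
    ∀ η ∈ R.dom, localNotion G.mem G.iter η = localNotion R.mem R.iter η := fun η hη =>
  (localNotion_congr hR.mem_subset (fun ζ hζ => (g.mem_old ζ hζ).symm)
    (fun ζ hζ => (g.iter_old ζ hζ).symm) η hη).symm

theorem notionIso (g : IsGraft σ τ P R G) (hP : IsRMI P.toIterData) (hR : IsRMI R.toIterData) :
    ∀ ξ ∈ P.dom, ∀ ξ' ∈ σ ξ,
      NotionIso σ τ (localNotion P.mem P.iter ξ) (localNotion G.mem G.iter ξ') :=
  notionIso_localNotion (X' := G.dom) g.inv g.dom_map.ge (fun ξ _ _ h => g.ran_subset ⟨ξ, h⟩)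
    hP.mem_subset (fun η hη _ hζ => (g.mem_subset hR η hη hζ).2) g.base.mem_eq g.iter_new
    (fun ξ hξ => hP.restrict_mem_notion ξ hξ ▸ (hP.iter_name ξ hξ).under_name)
    (fun ξ hξ => hP.restrict_mem_notion ξ hξ ▸ (hP.iter_name ξ hξ).order_name)

theorem isRMI (g : IsGraft σ τ P R G) (hP : IsRMI P.toIterData) (hR : IsRMI R.toIterData) :
    IsRMI G.toIterData := by
  have hG := g.mem_subset hR
  have hN := IterData.restrict_mem_notion hG g.notion_eq
  have hN' : G.notion = notionOver G.mem G.iter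
      (fun ξ => (G.toIterData.restrict (G.mem ξ)).notion) G.dom :=
    g.notion_eq.trans (notionOver_congr (fun _ _ => rfl) (fun _ _ => rfl)
      fun ξ hξ => (hN ξ hξ).symm)
  have hc : ∀ p, p ∈ G.carrier ↔ p ∈ G.notion.carrier := fun _ => Iff.rfl
  have hl : ∀ q p, G.le q p ↔ G.notion.le q p := fun _ _ => Iff.rfl
  exact
    { dom_bdd := g.dom_bdd
      mem_subset := hG
      mem_trans := by
        intro η hη ζ hζ
        rcases g.cases hη with h | ⟨ξ, hξ, h⟩
        · rw [g.mem_old η h] at hζ ⊢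
          rw [g.mem_old ζ (hR.mem_subset η h hζ).1]
          exact hR.mem_trans η h ζ hζ
        · rw [g.base.mem_eq ξ hξ η h] at hζ ⊢
          obtain ⟨ζ₀, hζ₀, hζ'⟩ := hζ
          rw [g.base.mem_eq ζ₀ (g.mem_dom hζ') ζ hζ']
          exact σ.image_mono (hP.mem_trans ξ hξ ζ₀ hζ₀)
      iter_name := by
        intro η hη
        rw [hN η hη]
        rcases g.cases hη with h | ⟨ξ, hξ, h⟩
        · rw [g.localNotion_old hR η h, g.iter_old η h, ← hR.restrict_mem_notion η h]
          exact hR.iter_name η h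
        · rw [g.iter_new ξ hξ η h]
          exact (g.notionIso hP hR ξ hξ η h).isPosetName
            (hP.restrict_mem_notion ξ hξ ▸ hP.iter_name ξ hξ)
      mem_carrier := fun p => by rw [hc, hN', mem_notionOver]
      le_iff := fun q p => by rw [hl, hc, hc, hN', notionOver_le]
      mem_off := g.mem_off
      iter_off := g.iter_off }

theorem baseClosed (g : IsGraft σ τ P R G) (hR : IsRMI R.toIterData) : G.BaseClosed R.dom :=
  ⟨g.old_subset, fun η hη => by
    rw [g.mem_old η hη]
    exact fun ζ hζ => (hR.mem_subset η hη hζ).1⟩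

theorem restrict_eq (g : IsGraft σ τ P R G) (hR : IsSimplifiedPP 𝒜 R) : G.restrict R.dom = R := by
  have hN : (G.toIterData.restrict R.dom).notion = R.notion := by
    rw [IterData.restrict_notion g.notion_eq g.old_subset, hR.rmi.notion_eq]
    exact notionOver_congr g.mem_old g.iter_old (g.localNotion_old hR.rmi)
  apply PPData.ext
  · exact Set.inter_eq_right.2 g.old_subset
  · funext η
    by_cases h : η ∈ R.dom
    · rw [PPData.restrict_mem h, g.mem_old η h]
    · rw [hR.rmi.mem_off η h]
      exact if_neg h
  · funext η
    by_cases h : η ∈ R.dom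
    · rw [PPData.restrict_iter h, g.iter_old η h]
    · rw [hR.rmi.iter_off η h]
      exact if_neg h
  · exact congrArg Notion.carrier hN
  · exact congrArg Notion.le hN
  · funext η
    by_cases h : η ∈ R.dom
    · rw [PPData.restrict_index h, g.index_old η h]
    · rw [hR.index_off η h]
      exact if_neg h
  · funext η
    by_cases h : η ∈ R.dom
    · rw [PPData.restrict_rmap h, g.rmap_old η h]
    · rw [hR.rmap_off η h]
      exact if_neg h

theorem restrict_eq_of_subset (g : IsGraft σ τ P R G) (hR : IsSimplifiedPP 𝒜 R)
    {Z : Set Ordinal.{u}} (hZ : Z ⊆ R.dom) : G.restrict Z = R.restrict Z := by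
  rw [← PPData.restrict_restrict G hZ, g.restrict_eq hR]

theorem isAcceptable_comp (g : IsGraft σ τ P R G) {π : PMap.{u}} {A : PPData.{u}}
    {x x' : Set Ordinal.{u}} (hπ : IsAcceptable π A.dom A.mem x') (hx' : x' = P.dom ∩ x)
    (hmem : ∀ ξ ∈ A.dom, ∀ ξ' ∈ π ξ, (P.restrict x).mem ξ' = π.image (A.mem ξ)) :
    IsAcceptable (σ.comp π) A.dom A.mem (σ.image x) := by
  have hσ : σ.image x = σ.image x' := by
    ext c
    constructor
    · rintro ⟨b, hb, hc⟩
      exact ⟨b, hx' ▸ ⟨g.mem_dom hc, hb⟩, hc⟩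
    · rintro ⟨b, hb, hc⟩
      rw [hx'] at hb
      exact ⟨b, hb.2, hc⟩
  rw [hσ]
  have hran := hπ.bij.ran_eq
  refine hπ.comp ?_ g.inj fun ξ hξ ζ hζ hb ξ' hξ' ζ' hζ' => ?_
  · rw [hx', g.dom_map]
    exact Set.inter_subset_left
  · have h₁ : ξ' ∈ P.dom ∩ x := by rw [← hx', ← hran]; exact ⟨ξ, hξ'⟩
    have h₂ := hmem ξ hξ ξ' hξ'
    rw [PPData.restrict_mem h₁.2] at h₂
    exact g.lt ξ' h₁.1 ζ' (h₂ ▸ ⟨ζ, hb, hζ'⟩)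

theorem isPPRearrangement (g : IsGraft σ τ P R G) (hP : IsPP 𝒜 φ P) (hR : IsPP 𝒜 φ R)
    {ξ η : Ordinal.{u}} (hξ : ξ ∈ P.dom) (hη : η ∈ σ ξ) :
    IsPPRearrangement (G.rmap η) (𝒜.P (G.index η)) (G.restrict (G.mem η)) := by
  have hPr := hP.simplified.rmi
  have hRr := hR.simplified.rmi
  obtain ⟨hit, hbase⟩ := hP.rearr ξ hξ
  have hsub : P.mem ξ ⊆ P.dom := fun ζ hζ => (hPr.mem_subset ξ hξ hζ).1
  have hran : ∀ ζ ∈ (𝒜.P (P.index ξ)).dom, ∀ ζ' ∈ P.rmap ξ ζ, ζ' ∈ P.dom ∩ P.mem ξ :=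
    fun ζ _ ζ' hζ' => (hit.acceptable.bij.ran_eq ▸ ⟨ζ, hζ'⟩ : ζ' ∈ (P.restrict (P.mem ξ)).dom)
  have hηG : η ∈ G.dom := g.ran_subset ⟨ξ, hη⟩
  have iso : NotionIso σ τ (P.restrict (P.mem ξ)).toIterData.notion
      (G.restrict (G.mem η)).toIterData.notion := by
    have := g.notionIso hPr hRr ξ hξ η hη
    rwa [← hPr.restrict_mem_notion ξ hξ,
      ← IterData.restrict_mem_notion (g.mem_subset hRr) g.notion_eq η hηG] at this
  have hmem := g.base.mem_eq ξ hξ η hη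
  have hdom : (G.restrict (G.mem η)).dom = σ.image (P.mem ξ) := by
    rw [PPData.restrict_dom, hmem, Set.inter_eq_right]
    exact (σ.image_subset_ran _).trans g.ran_subset
  have hcar : ∀ {p}, p ∈ (𝒜.P (P.index ξ)).carrier → rearrCond (P.rmap ξ) p ∈
      (P.restrict (P.mem ξ)).toIterData.notion.carrier := fun {p} hp =>
    (hit.carrier_eq ▸ ⟨p, hp, rfl⟩ : rearrCond (P.rmap ξ) p ∈ (P.restrict (P.mem ξ)).carrier)
  have hbase' : TransfersBase (σ.comp (P.rmap ξ)) (𝒜.P (P.index ξ)) (G.restrict (G.mem η)) := by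
    rw [hmem]
    exact hbase.comp g.base hran
  rw [g.base.rmap_eq ξ hξ η hη, g.base.index_eq ξ hξ η hη]
  exact
    { iteration :=
        { acceptable := by
            rw [hdom]
            exact g.isAcceptable_comp hit.acceptable rfl hbase.mem_eq
          mem_eq := hbase'.mem_eq
          iter_eq := by
            intro ζ hζ ζ'' hζ''
            obtain ⟨ζ', h, h'⟩ := PMap.mem_comp.1 hζ''
            have hx := hran ζ hζ ζ' h
            have hm : ζ'' ∈ G.mem η := hmem ▸ ⟨ζ', hx.2, h'⟩
            rw [PPData.restrict_iter hm, g.iter_new ζ' hx.1 ζ'' h', rearrPosetName_comp,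
              ← hit.iter_eq ζ hζ ζ' h, PPData.restrict_iter hx.2]
          carrier_eq := by
            refine iso.carrier_eq.trans ?_
            rw [funext (rearrCond_comp σ (P.rmap ξ))]
            refine (congrArg (rearrCond σ '' ·) hit.carrier_eq).trans ?_
            exact Set.image_image _ _ _
          le_iff := by
            intro q hq p hp
            rw [rearrCond_comp, rearrCond_comp]
            exact (iso.le_iff _ (hcar hq) _ (hcar hp)).trans (hit.le_iff q hq p hp) }
      base := hbase' }

theorem isPPRearrangement_of_mem_dom (g : IsGraft σ τ P R G) (hP : IsPP 𝒜 φ P) (hR : IsPP 𝒜 φ R) :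
    ∀ η ∈ G.dom, IsPPRearrangement (G.rmap η) (𝒜.P (G.index η)) (G.restrict (G.mem η)) := by
  intro η hη
  rcases g.cases hη with h | ⟨ξ, hξ, h⟩
  · rw [g.rmap_old η h, g.index_old η h, g.mem_old η h,
      g.restrict_eq_of_subset hR.simplified fun ζ hζ =>
        (hR.simplified.rmi.mem_subset η h hζ).1]
    exact hR.rearr η h
  · exact g.isPPRearrangement hP hR hξ h

theorem isSimplifiedPP (g : IsGraft σ τ P R G) (hP : IsPP 𝒜 φ P) (hR : IsPP 𝒜 φ R) :
    IsSimplifiedPP 𝒜 G where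
  rmi := g.isRMI hP.simplified.rmi hR.simplified.rmi
  index_mem η hη := by
    rcases g.cases hη with h | ⟨ξ, hξ, h⟩
    · exact g.index_old η h ▸ hR.simplified.index_mem η h
    · exact g.base.index_eq ξ hξ η h ▸ hP.simplified.index_mem ξ hξ
  rearr η hη := (g.isPPRearrangement_of_mem_dom hP hR η hη).iteration
  iter_eq η hη := by
    rcases g.cases hη with h | ⟨ξ, hξ, h⟩
    · rw [g.iter_old η h, g.rmap_old η h, g.index_old η h]
      exact hR.simplified.iter_eq η h
    · rw [g.iter_new ξ hξ η h, g.base.rmap_eq ξ hξ η h, g.base.index_eq ξ hξ η h,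
        hP.simplified.iter_eq ξ hξ, rearrPosetName_comp]
  index_off := g.index_off
  rmap_off := g.rmap_off

theorem baseTriple_old (g : IsGraft σ τ P R G) {η : Ordinal.{u}} (h : η ∈ R.dom) :
    G.baseTriple η = R.baseTriple η := by
  simp only [PPData.baseTriple, g.mem_old η h, g.rmap_old η h, g.index_old η h]

theorem baseTriple_new (g : IsGraft σ τ P R G) {ξ η : Ordinal.{u}} (hξ : ξ ∈ P.dom)
    (h : η ∈ σ ξ) : G.baseTriple η = (P.baseTriple ξ).push σ := by
  simp only [PPData.baseTriple, Triple.push, g.base.mem_eq ξ hξ η h, g.base.rmap_eq ξ hξ η h,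
    g.base.index_eq ξ hξ η h]

theorem isShadowBaseOf_old (g : IsGraft σ τ P R G) (hR : IsSimplifiedPP 𝒜 R) {t : Triple.{u}}
    (ht : IsShadowBaseOf 𝒜 R t) : IsShadowBaseOf 𝒜 G t where
  shadow := ht.shadow
  closed := ⟨ht.closed.1.trans g.old_subset, fun η hη => by
    rw [g.mem_old η (ht.closed.1 hη)]
    exact ht.closed.2 η hη⟩
  embeds := by
    rw [g.restrict_eq_of_subset hR ht.closed.1]
    exact ht.embeds

theorem isShadowBaseOf_push (g : IsGraft σ τ P R G) {s : Triple.{u}}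
    (hs : IsShadowBaseOf 𝒜 P s) : IsShadowBaseOf 𝒜 G (s.push σ) := by
  obtain ⟨⟨hC, γ, hγ, hacc⟩, hcl, hemb⟩ := hs
  have hran := hacc.bij.ran_eq
  have hdom := hacc.bij.dom_eq
  have hsd : s.set ⊆ σ.Dom := g.dom_map ▸ hcl.1
  have hA : ((𝒜.P s.index).restrict s.map.Dom).dom = Iio γ := by
    rw [PPData.restrict_dom, hdom, Set.inter_eq_right.2 hγ]
  have hacc' : IsAcceptable (σ.comp s.map) (Iio γ) ((𝒜.P s.index).restrict (Iio γ)).mem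
      (σ.image s.set) := by
    have := g.isAcceptable_comp (x := s.set) hemb.acceptable
      (by rw [hran, Set.inter_eq_right.2 hcl.1]) hemb.base.mem_eq
    rwa [hA, hdom] at this
  have hdom' : (σ.comp s.map).Dom = s.map.Dom := hacc'.bij.dom_eq.trans hdom.symm
  have hsub : σ.image s.set ⊆ G.dom := (σ.image_subset_ran _).trans g.ran_subset
  refine ⟨⟨hC, γ, hγ, hacc'⟩, ⟨hsub, ?_⟩, ?_⟩
  · rintro η ⟨ξ, hξ, hη⟩
    rw [g.base.mem_eq ξ (g.mem_dom hη) η hη]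
    exact σ.image_mono (hcl.2 ξ hξ)
  · show Embeds (σ.comp s.map) ((𝒜.P s.index).restrict (σ.comp s.map).Dom)
      (G.restrict (σ.image s.set))
    rw [hdom']
    refine ⟨?_, ?_, ?_⟩
    · rw [hacc'.bij.ran_eq, PPData.restrict_dom, Set.inter_eq_right.2 hsub]
    · rw [hA, hdom, hacc'.bij.ran_eq]
      exact hacc'
    · refine hemb.base.comp g.base fun ξ _ ξ' hξ' => ?_
      have : ξ' ∈ s.set := hran ▸ ⟨ξ, hξ'⟩
      exact ⟨hcl.1 this, this⟩

end IsGraft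

/-! ### Coherence of transported triples -/

theorem Triple.mem_restrict_map {s : Triple.{u}} {Z : Set Ordinal.{u}} {a b : Ordinal.{u}} :
    b ∈ (s.restrict Z).map a ↔ b ∈ s.map a ∧ b ∈ Z := by
  unfold Triple.restrict
  simp only [Option.mem_def, Option.bind_eq_some_iff, Option.ite_none_right_eq_some,
    Option.some.injEq]
  constructor
  · rintro ⟨_, h, hZ, rfl⟩
    exact ⟨h, hZ⟩
  · exact fun ⟨h, hZ⟩ => ⟨b, h, hZ, rfl⟩

theorem IsShadowBaseOf.ran_eq {𝒜 : AlphabetData.{u}} {R : PPData.{u}} {s : Triple.{u}}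
    (h : IsShadowBaseOf 𝒜 R s) : s.map.ran = s.set := by
  obtain ⟨-, γ, -, hacc⟩ := h.shadow
  exact hacc.bij.ran_eq

/-- If two triples look the same at the points of a set `Y`, then they cohere with the same triples
on subsets of `Y`. -/
structure Triple.AgreeOn (s s' : Triple.{u}) (Y : Set Ordinal.{u}) : Prop where
  index_eq : s.index = s'.index
  set_iff : ∀ ζ ∈ Y, ζ ∈ s.set ↔ ζ ∈ s'.set
  map_iff : ∀ ζ ∈ Y, ∀ μ, ζ ∈ s.map μ ↔ ζ ∈ s'.map μ
  image_eq : ∀ ζ ∈ Y, ∀ μ, ζ ∈ s.map μ → s.map.image (Iio μ) = s'.map.image (Iio μ)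

namespace Triple

variable {φ : Ordinal.{u} → Ordinal.{u} → PMap.{u}} {s s' t : Triple.{u}} {Y : Set Ordinal.{u}}

theorem AgreeOn.coheresTo_left (h : s.AgreeOn s' Y) (ht : t.set ⊆ Y)
    (hs : s'.CoheresTo φ t) : s.CoheresTo φ t := by
  intro hle ζ hζ μx μy hx hy
  have hY := ht hζ.2
  rw [h.image_eq ζ hY μx hx, h.index_eq]
  exact hs (h.index_eq ▸ hle) ζ ⟨(h.set_iff ζ hY).1 hζ.1, hζ.2⟩ μx μy ((h.map_iff ζ hY μx).1 hx) hy

theorem AgreeOn.coheresTo_right (h : s.AgreeOn s' Y) (ht : t.set ⊆ Y) (htr : t.map.ran ⊆ Y)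
    (hs : t.CoheresTo φ s') : t.CoheresTo φ s := by
  intro hle ζ hζ μx μy hx hy
  have hY := ht hζ.1
  have hpre : s.map.preimage (t.map.image (Iio μx)) = s'.map.preimage (t.map.image (Iio μx)) := by
    ext a
    exact exists_congr fun b => and_congr_right fun hb =>
      h.map_iff b (htr (t.map.image_subset_ran _ hb)) a
  rw [h.image_eq ζ hY μy hy, h.index_eq, hpre]
  exact hs (h.index_eq ▸ hle) ζ ⟨hζ.1, (h.set_iff ζ hY).1 hζ.2⟩ μx μy hx ((h.map_iff ζ hY μy).1 hy)

theorem CoheresTo.push {σ : PMap.{u}} (hσ : ∀ ξ ζ η, η ∈ σ ξ → η ∈ σ ζ → ξ = ζ)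
    (hs : s.map.ran ⊆ σ.Dom) (h : s.CoheresTo φ t) : (s.push σ).CoheresTo φ (t.push σ) := by
  rintro hle η ⟨⟨ζ, hζs, hη⟩, ζ₁, hζt, hη₁⟩ μx μy hx hy
  obtain rfl := hσ _ _ _ hη hη₁
  obtain ⟨ζ₁, hx, hη₁⟩ := PMap.mem_comp.1 hx
  obtain rfl := hσ _ _ _ hη hη₁
  obtain ⟨ζ₁, hy, hη₁⟩ := PMap.mem_comp.1 hy
  obtain rfl := hσ _ _ _ hη hη₁
  obtain ⟨h₁, h₂⟩ := h hle ζ ⟨hζs, hζt⟩ μx μy hx hy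
  have hpre : (σ.comp t.map).preimage (σ.image (s.map.image (Iio μx))) =
      t.map.preimage (s.map.image (Iio μx)) := by
    ext a
    constructor
    · rintro ⟨c, ⟨b, hb, hc⟩, hc'⟩
      obtain ⟨b', hb', hc'⟩ := PMap.mem_comp.1 hc'
      obtain rfl := hσ _ _ _ hc hc'
      exact ⟨b, hb, hb'⟩
    · rintro ⟨b, hb, hb'⟩
      obtain ⟨c, hc⟩ := hs (s.map.image_subset_ran _ hb)
      exact ⟨c, ⟨b, hb, hc⟩, PMap.mem_comp.2 ⟨b, hb', hc⟩⟩
  show (σ.comp s.map).image (Iio μx) ⊆ (σ.comp t.map).image (Iio μy) ∧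
    CoherentlyCollapses φ ((σ.comp t.map).preimage ((σ.comp s.map).image (Iio μx)))
      t.index μy s.index μx
  rw [PMap.image_comp, PMap.image_comp, hpre]
  exact ⟨σ.image_mono h₁, h₂⟩

theorem agreeOn_push {𝒜 : AlphabetData.{u}} {P : PPData.{u}} {B : Set Triple.{u}}
    {X₀ : Set Ordinal.{u}} (hX₀ : SetCoheres P B X₀) {σ σ' : PMap.{u}}
    (hσ : ∀ ξ ∈ X₀, σ' ξ = σ ξ) (hY : ∀ ξ, ∀ η ∈ σ' ξ, η ∈ Y → ξ ∈ X₀) (hs : s ∈ B)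
    (hsB : IsShadowBaseOf 𝒜 P s) :
    (s.push σ').AgreeOn ((s.restrict X₀).push σ) Y where
  index_eq := rfl
  set_iff η hη := by
    constructor
    · rintro ⟨ξ, hξ, h⟩
      have h₀ := hY ξ η h hη
      exact ⟨ξ, ⟨hξ, h₀⟩, hσ ξ h₀ ▸ h⟩
    · rintro ⟨ξ, hξ, h⟩
      exact ⟨ξ, hξ.1, (hσ ξ hξ.2).symm ▸ h⟩
  map_iff η hη μ := by
    simp only [push, PMap.mem_comp, mem_restrict_map]
    refine exists_congr fun ξ => ⟨fun ⟨h, h'⟩ => ?_, fun ⟨h, h'⟩ => ?_⟩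
    · have h₀ := hY ξ η h' hη
      exact ⟨⟨h, h₀⟩, hσ ξ h₀ ▸ h'⟩
    · exact ⟨h.1, (hσ ξ h.2).symm ▸ h'⟩
  image_eq η hη μ h := by
    obtain ⟨ξ, hξ, h'⟩ := PMap.mem_comp.1 h
    have hsub := hX₀.initial s hs ξ ⟨hY ξ η h' hη, hsB.ran_eq ▸ ⟨μ, hξ⟩⟩ μ hξ
    simp only [push]
    rw [PMap.image_comp, PMap.image_comp, PMap.image_congr fun ξ hξ => hσ ξ (hsub hξ)]
    congr 1
    ext ξ
    exact exists_congr fun a => and_congr_right fun ha =>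
      ⟨fun h => mem_restrict_map.2 ⟨h, hsub ⟨a, ha, h⟩⟩, fun h => (mem_restrict_map.1 h).1⟩

end Triple

theorem IsGraft.isEnrichedPP {𝒜 : AlphabetData.{u}} {φ : Ordinal.{u} → Ordinal.{u} → PMap.{u}}
    {σ σ' τ : PMap.{u}} {P R G : PPData.{u}} {B D : Set Triple.{u}} {X₀ : Set Ordinal.{u}}
    (g : IsGraft σ' τ P R G) (hP : IsEnrichedPP 𝒜 φ P B) (hR : IsEnrichedPP 𝒜 φ R D)
    (hX₀ : SetCoheres P B X₀) (hσ : ∀ ξ ∈ X₀, σ' ξ = σ ξ)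
    (hY : ∀ ξ, ∀ η ∈ σ' ξ, η ∈ R.dom → ξ ∈ X₀)
    (hD : ∀ s ∈ B, (s.restrict X₀).push σ ∈ D) :
    IsEnrichedPP 𝒜 φ G (D ∪ Triple.push σ' '' B) := by
  have hsh : ∀ s ∈ D ∪ Triple.push σ' '' B, IsShadowBaseOf 𝒜 G s := by
    rintro _ (ht | ⟨s, hs, rfl⟩)
    · exact g.isShadowBaseOf_old hR.pp.simplified (hR.enrichment.shadow _ ht)
    · exact g.isShadowBaseOf_push (hP.enrichment.shadow s hs)
  have hcoh : Coherent φ (D ∪ Triple.push σ' '' B) := by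
    have key := fun s (hs : s ∈ B) => Triple.agreeOn_push hX₀ hσ hY hs (hP.enrichment.shadow s hs)
    rintro s (hs | ⟨s, hs, rfl⟩) t (ht | ⟨t, ht, rfl⟩)
    · exact hR.enrichment.coherent s hs t ht
    · have hs' := hR.enrichment.shadow s hs
      exact (key t ht).coheresTo_right hs'.closed.1 (hs'.ran_eq.trans_subset hs'.closed.1)
        (hR.enrichment.coherent s hs _ (hD t ht))
    · exact (key s hs).coheresTo_left (hR.enrichment.shadow t ht).closed.1
        (hR.enrichment.coherent _ (hD s hs) t ht)
    · have hs' := hP.enrichment.shadow s hs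
      exact (hP.enrichment.coherent s hs t ht).push g.inj
        (by rw [hs'.ran_eq, g.dom_map]; exact hs'.closed.1)
  have hfull : ∀ η ∈ G.dom, G.baseTriple η ∈ D ∪ Triple.push σ' '' B := by
    intro η hη
    rcases g.cases hη with h | ⟨ξ, hξ, h⟩
    · exact Or.inl (g.baseTriple_old h ▸ hR.enrichment.full η h)
    · exact Or.inr ⟨_, hP.enrichment.full ξ hξ, (g.baseTriple_new hξ h).symm⟩
  exact
    { pp :=
        { simplified := g.isSimplifiedPP hP.pp hR.pp
          rearr := g.isPPRearrangement_of_mem_dom hP.pp hR.pp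
          coherent := fun ξ hξ ζ hζ => hcoh _ (hfull ξ hξ) _ (hfull ζ hζ) }
      enrichment := ⟨hsh, hcoh, hfull⟩ }

theorem IsGraft.embeds {σ τ : PMap.{u}} {P R G : PPData.{u}} (g : IsGraft σ τ P R G) :
    Embeds σ P G where
  ran_subset := g.ran_subset
  acceptable :=
    { bij := ⟨g.dom_map, rfl, g.inj⟩
      lt := fun ξ hξ _ _ hb ξ' hξ' ζ' hζ' => g.lt ξ hξ _ hb ξ' hξ' ζ' hζ' }
  base := g.base

/-! ### Existence of grafts -/

open Classical in
/-- The function equal to `f` on `Y`, to `g ∘ σ⁻¹` on the rest of the range of `σ`, and to `d`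
elsewhere. -/
noncomputable def graftFun {α : Type*} (Y : Set Ordinal.{u}) (σ : PMap.{u})
    (f g : Ordinal.{u} → α) (d : α) (η : Ordinal.{u}) : α :=
  if η ∈ Y then f η else (σ.inv η).elim d g

section graftFun

variable {α : Type*} {Y : Set Ordinal.{u}} {σ : PMap.{u}} {f g : Ordinal.{u} → α} {d : α}
  {ξ η : Ordinal.{u}}

theorem graftFun_old (h : η ∈ Y) : graftFun Y σ f g d η = f η := if_pos h

theorem graftFun_new (hσ : ∀ a b c, c ∈ σ a → c ∈ σ b → a = b) (h : η ∈ σ ξ)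
    (hfg : η ∈ Y → f η = g ξ) : graftFun Y σ f g d η = g ξ := by
  by_cases hY : η ∈ Y
  · rw [graftFun_old hY, hfg hY]
  · rw [graftFun, if_neg hY, Option.mem_def.1 ((PMap.mem_inv hσ ξ η).1 h), Option.elim_some]

theorem graftFun_off (hσ : ∀ a b c, c ∈ σ a → c ∈ σ b → a = b) (h : η ∉ Y ∪ σ.ran) :
    graftFun Y σ f g d η = d := by
  have hn : σ.inv η = none := Option.eq_none_iff_forall_not_mem.2 fun ξ hξ =>
    h (Or.inr ⟨ξ, (PMap.mem_inv hσ ξ η).2 hξ⟩)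
  rw [graftFun, if_neg fun hY => h (Or.inl hY), hn, Option.elim_none]

end graftFun

/-- The memory function of the graft of `P` onto `R` along `σ`. -/
noncomputable def graftMem (σ : PMap.{u}) (P R : PPData.{u}) : Ordinal.{u} → Set Ordinal.{u} :=
  graftFun R.dom σ R.mem (fun ξ => σ.image (P.mem ξ)) ∅

/-- The iterands of the graft of `P` onto `R` along `σ`. -/
noncomputable def graftIter (σ : PMap.{u}) (P R : PPData.{u}) : Ordinal.{u} → PosetName.{u} :=
  graftFun R.dom σ R.iter (fun ξ => rearrPosetName σ (P.iter ξ)) ⟨∅, ∅⟩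

/-- The graft of `P` onto `R` along `σ`. -/
noncomputable def graft (σ : PMap.{u}) (P R : PPData.{u}) : PPData.{u} where
  dom := R.dom ∪ σ.ran
  mem := graftMem σ P R
  iter := graftIter σ P R
  carrier := (notionOver (graftMem σ P R) (graftIter σ P R)
    (localNotion (graftMem σ P R) (graftIter σ P R)) (R.dom ∪ σ.ran)).carrier
  le := (notionOver (graftMem σ P R) (graftIter σ P R)
    (localNotion (graftMem σ P R) (graftIter σ P R)) (R.dom ∪ σ.ran)).le
  index := graftFun R.dom σ R.index P.index 0
  rmap := graftFun R.dom σ R.rmap (fun ξ => σ.comp (P.rmap ξ)) PMap.empty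

theorem isGraft_graft {σ : PMap.{u}} {P R : PPData.{u}}
    (inj : ∀ ξ ζ η, η ∈ σ ξ → η ∈ σ ζ → ξ = ζ) (hdom : σ.Dom = P.dom)
    (hlt : ∀ ξ ∈ P.dom, ∀ ζ ∈ P.mem ξ, ∀ ξ' ∈ σ ξ, ∀ ζ' ∈ σ ζ, ζ' < ξ')
    (hbdd : BddAbove (R.dom ∪ σ.ran))
    (hmem : ∀ ξ ∈ P.dom, ∀ η ∈ σ ξ, η ∈ R.dom → R.mem η = σ.image (P.mem ξ))
    (hiter : ∀ ξ ∈ P.dom, ∀ η ∈ σ ξ, η ∈ R.dom → R.iter η = rearrPosetName σ (P.iter ξ))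
    (hindex : ∀ ξ ∈ P.dom, ∀ η ∈ σ ξ, η ∈ R.dom → R.index η = P.index ξ)
    (hrmap : ∀ ξ ∈ P.dom, ∀ η ∈ σ ξ, η ∈ R.dom → R.rmap η = σ.comp (P.rmap ξ)) :
    IsGraft σ σ.inv P R (graft σ P R) where
  inv := PMap.mem_inv inj
  dom_map := hdom
  lt := hlt
  dom_eq := rfl
  dom_bdd := hbdd
  mem_old _ := graftFun_old
  iter_old _ := graftFun_old
  index_old _ := graftFun_old
  rmap_old _ := graftFun_old
  base :=
    { mem_eq := fun ξ hξ η h => graftFun_new inj h (hmem ξ hξ η h)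
      rmap_eq := fun ξ hξ η h => graftFun_new inj h (hrmap ξ hξ η h)
      index_eq := fun ξ hξ η h => graftFun_new inj h (hindex ξ hξ η h) }
  iter_new ξ hξ η h := graftFun_new (g := fun ξ => rearrPosetName σ (P.iter ξ)) inj h
    (hiter ξ hξ η h)
  mem_off _ := graftFun_off inj
  iter_off _ := graftFun_off inj
  index_off _ := graftFun_off inj
  rmap_off _ := graftFun_off inj
  notion_eq := rfl

/-! ### Extending an embedding -/

open Classical in
/-- The extension of `σ` from `X₀` to `X` which shifts the elements of `X \ X₀` by `l`. -/
noncomputable def shiftExtend (X₀ X : Set Ordinal.{u}) (l : Ordinal.{u}) (σ : PMap.{u}) :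
    PMap.{u} := fun ξ => if ξ ∈ X₀ then σ ξ else if ξ ∈ X then some (l + ξ) else none

section shiftExtend

variable {X₀ X : Set Ordinal.{u}} {l : Ordinal.{u}} {σ : PMap.{u}} {ξ η : Ordinal.{u}}

theorem shiftExtend_old (h : ξ ∈ X₀) : shiftExtend X₀ X l σ ξ = σ ξ := if_pos h

theorem mem_shiftExtend_new (h : ξ ∉ X₀) : η ∈ shiftExtend X₀ X l σ ξ ↔ ξ ∈ X ∧ η = l + ξ := by
  rw [shiftExtend, if_neg h]
  split_ifs with hX
  · simp [hX, eq_comm]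
  · simp [hX]

theorem shiftExtend_dom (hX₀ : X₀ ⊆ X) (hσ : σ.Dom = X₀) : (shiftExtend X₀ X l σ).Dom = X := by
  ext ξ
  by_cases h : ξ ∈ X₀
  · refine iff_of_true ?_ (hX₀ h)
    rw [← hσ] at h
    obtain ⟨η, hη⟩ := h
    exact ⟨η, by rwa [shiftExtend_old (hσ ▸ ⟨η, hη⟩)]⟩
  · exact ⟨fun ⟨η, hη⟩ => ((mem_shiftExtend_new h).1 hη).1,
      fun hX => ⟨_, (mem_shiftExtend_new h).2 ⟨hX, rfl⟩⟩⟩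

theorem lt_iff_of_mem_shiftExtend (hl : ∀ b ∈ σ.ran, b < l) (h : η ∈ shiftExtend X₀ X l σ ξ) :
    η < l ↔ ξ ∈ X₀ := by
  by_cases hξ : ξ ∈ X₀
  · rw [shiftExtend_old hξ] at h
    exact iff_of_true (hl η ⟨ξ, h⟩) hξ
  · obtain ⟨-, rfl⟩ := (mem_shiftExtend_new hξ).1 h
    exact iff_of_false (not_lt.2 le_self_add) hξ

theorem shiftExtend_inj (hl : ∀ b ∈ σ.ran, b < l)
    (hσ : ∀ ξ ζ η, η ∈ σ ξ → η ∈ σ ζ → ξ = ζ) : ∀ ξ ζ η,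
    η ∈ shiftExtend X₀ X l σ ξ → η ∈ shiftExtend X₀ X l σ ζ → ξ = ζ := by
  intro ξ ζ η h₁ h₂
  have e := (lt_iff_of_mem_shiftExtend hl h₁).symm.trans (lt_iff_of_mem_shiftExtend hl h₂)
  by_cases h : ξ ∈ X₀
  · rw [shiftExtend_old h] at h₁
    rw [shiftExtend_old (e.1 h)] at h₂
    exact hσ _ _ _ h₁ h₂
  · obtain ⟨-, h₁⟩ := (mem_shiftExtend_new h).1 h₁
    obtain ⟨-, h₂⟩ := (mem_shiftExtend_new (mt e.2 h)).1 h₂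
    exact add_left_cancel (h₁.symm.trans h₂)

theorem shiftExtend_lt (hl : ∀ b ∈ σ.ran, b < l) {b : Ordinal.{u} → Set Ordinal.{u}}
    (hX₀ : ∀ ξ ∈ X₀, b ξ ⊆ X₀) (hb : ∀ ξ ∈ X, b ξ ⊆ Iio ξ)
    (hσ : ∀ ξ ∈ X₀, ∀ ζ ∈ X₀, ζ ∈ b ξ → ∀ ξ' ∈ σ ξ, ∀ ζ' ∈ σ ζ, ζ' < ξ') :
    ∀ ξ ∈ X, ∀ ζ ∈ b ξ, ∀ ξ' ∈ shiftExtend X₀ X l σ ξ, ∀ ζ' ∈ shiftExtend X₀ X l σ ζ,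
      ζ' < ξ' := by
  intro ξ hξ ζ hζ ξ' hξ' ζ' hζ'
  by_cases h : ξ ∈ X₀
  · have h' := hX₀ ξ h hζ
    rw [shiftExtend_old h] at hξ'
    rw [shiftExtend_old h'] at hζ'
    exact hσ ξ h ζ h' hζ ξ' hξ' ζ' hζ'
  · obtain ⟨-, rfl⟩ := (mem_shiftExtend_new h).1 hξ'
    by_cases h' : ζ ∈ X₀
    · exact ((lt_iff_of_mem_shiftExtend hl hζ').2 h').trans_le le_self_add
    · obtain ⟨-, rfl⟩ := (mem_shiftExtend_new h').1 hζ'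
      exact (add_lt_add_iff_left l).2 (hb ξ hξ hζ)

end shiftExtend

theorem exists_isGraft {𝒜 : AlphabetData.{u}} {φ : Ordinal.{u} → Ordinal.{u} → PMap.{u}}
    {P R : PPData.{u}} (hP : IsPP 𝒜 φ P) (hR : IsPP 𝒜 φ R) {X₀ : Set Ordinal.{u}}
    (hX₀ : P.BaseClosed X₀) {σ : PMap.{u}} (hσ : Embeds σ (P.restrict X₀) R) :
    ∃ (σ' τ : PMap.{u}) (G : PPData.{u}), IsGraft σ' τ P R G ∧ (∀ ξ ∈ X₀, σ' ξ = σ ξ) ∧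
      ∀ ξ, ∀ η ∈ σ' ξ, η ∈ R.dom ↔ ξ ∈ X₀ := by
  have hPr := hP.simplified.rmi
  have hRr := hR.simplified.rmi
  obtain ⟨M, hM⟩ := hRr.dom_bdd
  obtain ⟨K, hK⟩ := hPr.dom_bdd
  have hl : ∀ b ∈ R.dom, b < Order.succ M := fun b hb => Order.lt_succ_of_le (hM hb)
  have hl' : ∀ b ∈ σ.ran, b < Order.succ M := fun b hb => hl b (hσ.ran_subset hb)
  have hdom : (P.restrict X₀).dom = X₀ := Set.inter_eq_right.2 hX₀.1
  have hσX : σ.Dom = X₀ := hσ.acceptable.bij.dom_eq.trans hdom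
  set σ' := shiftExtend X₀ P.dom (Order.succ M) σ with hσ'
  have hold : ∀ ξ ∈ X₀, σ' ξ = σ ξ := fun ξ => shiftExtend_old
  have hY : ∀ ξ, ∀ η ∈ σ' ξ, η ∈ R.dom ↔ ξ ∈ X₀ := by
    refine fun ξ η h => ⟨fun hη => (lt_iff_of_mem_shiftExtend hl' h).1 (hl η hη), fun hξ => ?_⟩
    rw [hold ξ hξ] at h
    exact hσ.ran_subset ⟨ξ, h⟩
  have hback : ∀ ξ, ∀ η ∈ σ' ξ, η ∈ R.dom → ξ ∈ X₀ ∧ η ∈ σ ξ := fun ξ η h hη =>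
    have hξ := (hY ξ η h).1 hη
    ⟨hξ, hold ξ hξ ▸ h⟩
  have hmem : ∀ ξ ∈ P.dom, ∀ η ∈ σ' ξ, η ∈ R.dom → R.mem η = σ'.image (P.mem ξ) := by
    intro ξ _ η h hη
    obtain ⟨h₀, h⟩ := hback ξ η h hη
    rw [hσ.base.mem_eq ξ (hdom.symm ▸ h₀) η h, PPData.restrict_mem h₀]
    exact PMap.image_congr fun ζ hζ => (hold ζ (hX₀.2 ξ h₀ hζ)).symm
  have hindex : ∀ ξ ∈ P.dom, ∀ η ∈ σ' ξ, η ∈ R.dom → R.index η = P.index ξ := by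
    intro ξ _ η h hη
    obtain ⟨h₀, h⟩ := hback ξ η h hη
    rw [hσ.base.index_eq ξ (hdom.symm ▸ h₀) η h, PPData.restrict_index h₀]
  have hrmap : ∀ ξ ∈ P.dom, ∀ η ∈ σ' ξ, η ∈ R.dom → R.rmap η = σ'.comp (P.rmap ξ) := by
    intro ξ hξ η h hη
    obtain ⟨h₀, h⟩ := hback ξ η h hη
    rw [hσ.base.rmap_eq ξ (hdom.symm ▸ h₀) η h, PPData.restrict_rmap h₀]
    refine PMap.comp_congr fun ζ hζ => (hold ζ (hX₀.2 ξ h₀ ?_)).symm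
    rw [(hP.rearr ξ hξ).iteration.acceptable.bij.ran_eq] at hζ
    exact hζ.2
  refine ⟨σ', σ'.inv, graft σ' P R, isGraft_graft (shiftExtend_inj hl' hσ.acceptable.bij.inj)
    (shiftExtend_dom hX₀.1 hσX) ?_ ?_ hmem ?_ hindex hrmap, hold, hY⟩
  · refine shiftExtend_lt hl' hX₀.2 (fun ξ hξ ζ hζ => (hPr.mem_subset ξ hξ hζ).2)
      fun ξ hξ ζ hζ hb => ?_
    refine hσ.acceptable.lt ξ (hdom.symm ▸ hξ) ζ (hdom.symm ▸ hζ) ?_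
    rwa [PPData.restrict_mem hξ]
  · refine ⟨Order.succ M + K, ?_⟩
    rintro η (hη | ⟨ξ, h⟩)
    · exact (hl η hη).le.trans le_self_add
    · by_cases h₀ : ξ ∈ X₀
      · exact (hl η ((hY ξ η h).2 h₀)).le.trans le_self_add
      · obtain ⟨hξ, rfl⟩ := (mem_shiftExtend_new h₀).1 h
        exact (add_le_add_iff_left _).2 (hK hξ)
  · intro ξ hξ η h hη
    rw [hR.simplified.iter_eq η hη, hrmap ξ hξ η h hη, hindex ξ hξ η h hη, rearrPosetName_comp,
      ← hP.simplified.iter_eq ξ hξ]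

end PartitionProducts

theorem lemma3p10
    (𝒜 : PartitionProducts.AlphabetData.{u})
    (φ : Ordinal.{u} → Ordinal.{u} → PartitionProducts.PMap.{u})
    (hφ : PartitionProducts.IsCollapsingSystem 𝒜 φ)
    (h𝒜 : PartitionProducts.IsAlphabet 𝒜 φ)
    (P R : PartitionProducts.PPData.{u}) (B D : Set PartitionProducts.Triple.{u})
    (hP : PartitionProducts.IsEnrichedPP 𝒜 φ P B)
    (hR : PartitionProducts.IsEnrichedPP 𝒜 φ R D)
    (X₀ : Set Ordinal.{u}) (hX₀ : PartitionProducts.SetCoheres P B X₀)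
    (σ : PartitionProducts.PMap.{u})
    (hσ : PartitionProducts.EmbedsEnriched σ (P.restrict X₀)
      ((fun s => PartitionProducts.Triple.restrict s X₀) '' B) R D) :
    ∃ (R' : PartitionProducts.PPData.{u}) (D' : Set PartitionProducts.Triple.{u}),
      PartitionProducts.IsEnrichedPP 𝒜 φ R' D' ∧
      R.dom ⊆ R'.dom ∧ R'.BaseClosed R.dom ∧ R'.restrict R.dom = R ∧ D ⊆ D' ∧
      ∃ σ' : PartitionProducts.PMap.{u},
        (∀ ξ ∈ X₀, σ' ξ = σ ξ) ∧
        PartitionProducts.EmbedsEnriched σ' P B R' D' ∧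
        σ'.image (P.dom \ X₀) = R'.dom \ R.dom := by
  obtain ⟨σ', τ, G, g, hold, hY⟩ :=
    PartitionProducts.exists_isGraft hP.pp hR.pp hX₀.closed hσ.embeds
  refine ⟨G, D ∪ PartitionProducts.Triple.push σ' '' B,
    g.isEnrichedPP hP hR hX₀ hold (fun ξ η h => (hY ξ η h).1)
      fun s hs => hσ.push_subset ⟨_, ⟨s, hs, rfl⟩, rfl⟩,
    g.old_subset, g.baseClosed hR.pp.simplified.rmi, g.restrict_eq hR.pp.simplified,
    Set.subset_union_left, σ', hold, ⟨g.embeds, Set.subset_union_right⟩, ?_⟩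
  ext η
  constructor
  · rintro ⟨ξ, ⟨-, hξ⟩, h⟩
    exact ⟨g.ran_subset ⟨ξ, h⟩, fun hη => hξ ((hY ξ η h).1 hη)⟩
  · rintro ⟨hη, hη'⟩
    obtain h | ⟨ξ, hξ, h⟩ := g.cases hη
    · exact absurd h hη'
    · exact ⟨ξ, ⟨hξ, fun h₀ => hη' ((hY ξ η h).2 h₀)⟩, h⟩
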